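/- **Conventions.** All groups are discrete. A group has a property *locally* if all its finitely generated subgroups have it; it is *virtually abelian* if it has an abelian subgroup of finite index. Say that a group $G$ has an *LVA-series* if there is a subnormal series $\{1\}=H_0\triangleleft H_1\triangleleft\cdots\triangleleft H_n=G$ in which every factor $H_{i+1}/H_i$ is locally virtually abelian. A *pointed dynamical system* $(G,X,0)$ is a group $G$ acting continuously on a compact metric space $(X,d)$ with a point $0\in X$ fixed by $G$. It is *expansive* if there is $0<\Delta\le 1$ such that $d(g x,g y)\le\Delta$ for all $g\in G$ implies $x=y$. A point $x$ is *homoclinic* if for every $\epsilon>0$ one has $d(gx,0)<\epsilon$ for all but finitely many $g\in G$. For $E\subseteq G$ and $\delta>0$, a *$(\delta,E)$-designation* is a family $(A_i,x_i)_{i\in I}$ such that $(A_i)_{i\in I}$ is a partition of $G$, $x_i\in X$, and $d(gx_i,0)<\delta$ whenever $g\in A_i$ and $Eg\not\subseteq A_i$; an *$\epsilon$-realization* of it is a point $y\in X$ with $d(gy,gx_i)<\epsilon$ for all $i\in I$ and $g\in A_i$. The system is *$0$-gluing* if for every $\epsilon>0$ there are $\delta>0$ and a finite $E\subseteq G$ such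 that every $(\delta,E)$-designation has an $\epsilon$-realization. An *endomorphism* is a continuous $G$-equivariant map $f:X\to X$ with $f(0)=0$. A map $f:X\to X$ is *asymptotically nilpotent* if $f^n(x)\to 0$ for every $x\in X$, and *nilpotent* if $f^n(X)=\{0\}$ for some $n$. A *tiered dynamical system* $\mathcal X$ consists of a compact metric space $X$ with a point $0\in X$, a directed set $\mathcal T$ with least element $t_0$, for each $t\in\mathcal T$ an expansive pointed dynamical system $(G_t,X_t,0)$ with $0\in X_t\subseteq X$, such that $X_t\subseteq X_{t'}$ for $t\le t'$, and finite-to-one surjective homomorphisms $\phi^{t'}_t:G_{t'}\to G_t$ for $t\le t'$ with $\phi^t_t=\mathrm{id}$, $\phi^{t'}_t\circ\phi^{t''}_{t'}=\phi^{t''}_t$ for $t\le t'\le t''$, and $\phi^{t'}_t(g)\cdot x=g\cdot x$ for $t\le t'$, $x\in X_t$, $g\in G_{t'}$. Its *base group* is $G_{t_0}$. An *evolution* of $\mathcal X$ is a continuous map $f:X\to X$ such that, for $t\le t'$ and $x\in X_t$ with $f(x)\in X_{t'}$, one has $f(\phi^{t'}_t(g)\cdot x)=g\cdot f(x)$ for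 all $g\in G_{t'}$. The pair $(\mathcal X,f)$ belongs to $\mathfrak C_2$ if for every $t\in\mathcal T$: - there is $s\ge t$ with $f^k(X_t)\subseteq X_s$ for all $k\ge0$; - there is $w\ge t$ such that for every $\epsilon>0$ there are $\delta>0$ and a finite $E\subseteq G_w$ such that every $(\delta,E)$-designation $(A_i,x_i)_{i\in I}$ in $(G_w,X_w,0)$ with all $x_i\in X_t$ has an $\epsilon$-realization in $X_w$; - for every $x\in X_t$ and $\epsilon>0$ there are $t'\ge t$ and a homoclinic point $y$ of $(G_{t'},X_{t'},0)$ with $d(x,y)<\epsilon$. It belongs to $\mathfrak C_3$ if moreover all the groups $G_t$ are residually finite, and to $\mathfrak C_4$ if it belongs to $\mathfrak C_2$ and $\mathcal T$ has a single element. A group $G$ is *nil-rigid on* $\mathfrak C$ if for every tiered system $\mathcal X$ with base group $G$ and every asymptotically nilpotent evolution $f:X\to X$ with $(\mathcal X,f)\in\mathfrak C$, for each $t\in\mathcal T$ there is $n$ with $f^n(x)=0$ for all $x\in X_t$. **Theorem.** 1. Let $G$ be a group such that every finitely generated subgroup of $G$ is residually finite and has an LVA-series. Let $(G,X,0)$ be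 an expansive $0$-gluing pointed dynamical system whose homoclinic points are dense in $X$. Then every asymptotically nilpotent endomorphism $f:X\to X$ is nilpotent. 2. Every residually finite group with an LVA-series is nil-rigid on $\mathfrak C_3$. 3. If a group $G$ is locally nil-rigid on $\mathfrak C_2$, or locally nil-rigid on $\mathfrak C_4$, or both locally nil-rigid on $\mathfrak C_3$ and locally residually finite, then $G$ is nil-rigid on $\mathfrak C_4$. -/

import Mathlib

open Filter Topology

universe u v

/-! ### Classes of groups -/

/-- `G` has an abelian subgroup of finite index. -/
def IsVirtuallyAbelian (G : Type u) [Group G] : Prop :=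
  ∃ A : Subgroup G, A.FiniteIndex ∧ IsMulCommutative A

/-- Every finitely generated subgroup of `G` is virtually abelian. -/
def IsLocallyVirtuallyAbelian (G : Type u) [Group G] : Prop :=
  ∀ H : Subgroup G, H.FG → IsVirtuallyAbelian H

/-- `G` has a subnormal series `1 = S 0 ◁ S 1 ◁ ⋯ ◁ S n = G` (of some length `n ≥ 0`) in which every
factor `S (i + 1) / S i` is locally virtually abelian. -/
def HasLocallyVirtuallyAbelianSeries (G : Type u) [Group G] : Prop :=
  ∃ (n : ℕ) (S : ℕ → Subgroup G), S 0 = ⊥ ∧ S n = ⊤ ∧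
    ∀ i < n, S i ≤ S (i + 1) ∧
      ∃ _ : ((S i).subgroupOf (S (i + 1))).Normal,
        IsLocallyVirtuallyAbelian (S (i + 1) ⧸ (S i).subgroupOf (S (i + 1)))

/-! ### Pointed dynamical systems

A pointed dynamical system is a group `G` acting by homeomorphisms on a compact metric space `X`,
with a point `o : X` fixed by `G`. -/

section Systems

variable (G : Type u) {X : Type v} [Group G] [MetricSpace X] [MulAction G X]

/-- `Δ` is an expansivity constant of the system. -/
def IsExpansivityConstant (X : Type v) [MetricSpace X] [MulAction G X] (Δ : ℝ) : Prop :=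
  0 < Δ ∧ Δ ≤ 1 ∧ ∀ x y : X, (∀ g : G, dist (g • x) (g • y) ≤ Δ) → x = y

/-- The action of `G` on `X` is expansive. -/
def IsExpansive (X : Type v) [MetricSpace X] [MulAction G X] : Prop :=
  ∃ Δ : ℝ, IsExpansivityConstant G X Δ

/-- `x` is homoclinic (to `o`). -/
def IsHomoclinic (o x : X) : Prop :=
  ∀ ε > (0 : ℝ), ∃ E : Set G, E.Finite ∧ ∀ g ∉ E, dist (g • x) o < ε

variable {G}

/-- The `E`-border of `A`. -/
def border (E A : Set G) : Set G :=
  {g | g ∈ A ∧ ∃ e ∈ E, e * g ∉ A}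

/-- The family `(A i, x i)` is a designation: the sets `A i` are disjoint and cover `G`. (Empty parts
are allowed; they put no condition on anything.) It is moreover a `(δ, E)`-designation: the orbit of
`x i` is `δ`-close to `o` on the `E`-border of `A i`. -/
def IsDesignation (o : X) (δ : ℝ) (E : Set G) {I : Type u} (A : I → Set G) (x : I → X) : Prop :=
  Pairwise (fun i j => Disjoint (A i) (A j)) ∧ (⋃ i, A i) = Set.univ ∧
    ∀ i, ∀ g ∈ border E (A i), dist (g • x i) o < δ

/-- `y` is an `ε`-realization of the designation `(A i, x i)`. -/
def IsRealization (ε : ℝ) {I : Type u} (A : I → Set G) (x : I → X) (y : X) : Prop :=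
  ∀ i, ∀ g ∈ A i, dist (g • y) (g • x i) < ε

variable (G)

/-- The pointed system `(G, X, o)` is `0`-gluing. -/
def IsZeroGluing (o : X) : Prop :=
  ∀ ε > (0 : ℝ), ∃ δ > (0 : ℝ), ∃ E : Set G, E.Finite ∧
    ∀ (I : Type u) (A : I → Set G) (x : I → X), IsDesignation o δ E A x →
      ∃ y : X, IsRealization ε A x y

/-- `f` is an endomorphism of the pointed system `(G, X, o)`. -/
def IsEndomorphism (o : X) (f : X → X) : Prop :=
  Continuous f ∧ f o = o ∧ ∀ (g : G) (x : X), f (g • x) = g • f x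

end Systems

/-- `f ^ n (x) → o` for every `x`. -/
def IsAsymptoticallyNilpotent {X : Type v} [MetricSpace X] (o : X) (f : X → X) : Prop :=
  ∀ x, Tendsto (fun n => f^[n] x) atTop (𝓝 o)

/-- `f ^ n (X) = {o}` for some `n`. -/
def IsNilpotentMap {X : Type v} (o : X) (f : X → X) : Prop :=
  ∃ n : ℕ, Set.range f^[n] = {o}

/-- There is an `n` with `f ^ n (x) = o` for all `x ∈ Y`. -/
def IsNilpotentMapOn {X : Type v} (o : X) (f : X → X) (Y : Set X) : Prop :=
  ∃ n : ℕ, ∀ x ∈ Y, f^[n] x = o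

/-! ### Tiered dynamical systems -/

/-- A tiered dynamical system: a compact metric ambient space with a special point, a directed set of
tiers with a least element, and on each tier (a closed subset containing the special point) an
expansive pointed action of a group of its own; the tiers increase, and the group of a higher tier
maps onto that of a lower tier, with finite fibres and compatibly with the actions. -/
structure TieredSystem where
  /-- the ambient space -/
  Space : Type v
  [metricSpace : MetricSpace Space]
  [compactSpace : CompactSpace Space]
  /-- the special point -/
  zero : Space
  /-- the directed set of tiers -/
  Tier : Type u
  [preorder : Preorder Tier]
  [orderBot : OrderBot Tier]
  [directed : IsDirectedOrder Tier]
  /-- the acting groups -/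
  Grp : Tier → Type u
  [group : ∀ t, Group (Grp t)]
  /-- the subset of the ambient space belonging to a tier -/
  set : Tier → Set Space
  isCompact_set : ∀ t, IsCompact (set t)
  [mulAction : ∀ t, MulAction (Grp t) (set t)]
  [continuousConstSMul : ∀ t, ContinuousConstSMul (Grp t) (set t)]
  zero_mem : ∀ t, zero ∈ set t
  smul_zero : ∀ t (g : Grp t), g • (⟨zero, zero_mem t⟩ : set t) = ⟨zero, zero_mem t⟩
  expansive : ∀ t, IsExpansive (Grp t) (set t)
  set_mono : ∀ {t t' : Tier}, t ≤ t' → set t ⊆ set t'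
  /-- the homomorphism from the group of a higher tier to the group of a lower tier -/
  hom : ∀ {t t' : Tier}, t ≤ t' → Grp t' →* Grp t
  hom_surjective : ∀ {t t' : Tier} (h : t ≤ t'), Function.Surjective (hom h)
  hom_finite_fibre : ∀ {t t' : Tier} (h : t ≤ t') (g : Grp t), (hom h ⁻¹' {g}).Finite
  hom_refl : ∀ t, hom (le_refl t) = MonoidHom.id (Grp t)
  hom_comp : ∀ {t t' t'' : Tier} (h : t ≤ t') (h' : t' ≤ t''),
    (hom h).comp (hom h') = hom (h.trans h')
  hom_smul : ∀ {t t' : Tier} (h : t ≤ t') (g : Grp t') (x : set t),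
    ((hom h g • x : set t) : Space) = (g • (⟨x, set_mono h x.2⟩ : set t') : set t')

namespace TieredSystem

attribute [instance] TieredSystem.metricSpace TieredSystem.compactSpace TieredSystem.preorder
  TieredSystem.orderBot TieredSystem.directed TieredSystem.group TieredSystem.mulAction
  TieredSystem.continuousConstSMul

variable (𝒳 : TieredSystem.{u, v})

/-- The special point, as a point of the tier `t`. -/
def zeroAt (t : 𝒳.Tier) : 𝒳.set t := ⟨𝒳.zero, 𝒳.zero_mem t⟩

/-- `f` is an evolution map: it is continuous, and if `t ≤ t'`, `x ∈ X_t` and `f x ∈ X_{t'}`, then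
`f (φ(g) • x) = g • f x` for every `g ∈ G_{t'}`, where `φ : G_{t'} → G_t`. -/
def IsEvolution (f : 𝒳.Space → 𝒳.Space) : Prop :=
  Continuous f ∧
    ∀ (t t' : 𝒳.Tier) (h : t ≤ t') (x : 𝒳.set t) (hx : f x ∈ 𝒳.set t') (g : 𝒳.Grp t'),
      f (𝒳.hom h g • x : 𝒳.set t) = (g • (⟨f x, hx⟩ : 𝒳.set t') : 𝒳.set t')

/-- Every tier is `f`-stabilizing. -/
def IsStabilizing (f : 𝒳.Space → 𝒳.Space) : Prop :=
  ∀ t : 𝒳.Tier, ∃ s ≥ t, ∀ k : ℕ, f^[k] '' 𝒳.set t ⊆ 𝒳.set s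

/-- Every tier is weakly `0`-gluing. -/
def IsWeaklyZeroGluing : Prop :=
  ∀ t : 𝒳.Tier, ∃ w ≥ t, ∀ ε > (0 : ℝ), ∃ δ > (0 : ℝ), ∃ E : Set (𝒳.Grp w), E.Finite ∧
    ∀ (I : Type u) (A : I → Set (𝒳.Grp w)) (x : I → 𝒳.set w),
      (∀ i, (x i : 𝒳.Space) ∈ 𝒳.set t) → IsDesignation (𝒳.zeroAt w) δ E A x →
        ∃ y : 𝒳.set w, IsRealization ε A x y

/-- The system has weakly dense homoclinic points. -/
def HasWeaklyDenseHomoclinicPoints : Prop :=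
  ∀ (t : 𝒳.Tier), ∀ x ∈ 𝒳.set t, ∀ ε > (0 : ℝ), ∃ t' ≥ t, ∃ y : 𝒳.set t',
    dist x (y : 𝒳.Space) < ε ∧ IsHomoclinic (𝒳.Grp t') (𝒳.zeroAt t') y

end TieredSystem

/-- A class of evolutions of tiered dynamical systems. -/
abbrev EvolutionClass := (𝒳 : TieredSystem.{u, v}) → (𝒳.Space → 𝒳.Space) → Prop

/-- The class `ℭ₂`. -/
def classTwo : EvolutionClass.{u, v} := fun 𝒳 f =>
  𝒳.IsEvolution f ∧ 𝒳.IsStabilizing f ∧ 𝒳.IsWeaklyZeroGluing ∧ 𝒳.HasWeaklyDenseHomoclinicPoints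

/-- The class `ℭ₃`: all the acting groups are residually finite. -/
def classThree : EvolutionClass.{u, v} := fun 𝒳 f =>
  classTwo 𝒳 f ∧ ∀ t, Group.ResiduallyFinite (𝒳.Grp t)

/-- The class `ℭ₄`: there is a single tier. -/
def classFour : EvolutionClass.{u, v} := fun 𝒳 f =>
  classTwo 𝒳 f ∧ Subsingleton 𝒳.Tier

/-- `G` is nil-rigid on the class `ℭ`: for every tiered system with base group `G` (up to isomorphism),
every asymptotically nilpotent evolution map that puts the system in `ℭ` is nilpotent on each tier. -/
def IsNilRigidOn (ℭ : EvolutionClass.{u, v}) (G : Type u) [Group G] : Prop :=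
  ∀ 𝒳 : TieredSystem.{u, v}, Nonempty (𝒳.Grp ⊥ ≃* G) →
    ∀ f : 𝒳.Space → 𝒳.Space, 𝒳.IsEvolution f → ℭ 𝒳 f →
      IsAsymptoticallyNilpotent 𝒳.zero f → ∀ t, IsNilpotentMapOn 𝒳.zero f (𝒳.set t)

/-- Every finitely generated subgroup of `G` is nil-rigid on `ℭ`. -/
def IsLocallyNilRigidOn (ℭ : EvolutionClass.{u, v}) (G : Type u) [Group G] : Prop :=
  ∀ H : Subgroup G, H.FG → IsNilRigidOn ℭ H

/-!
Expansiveness gives an asymptotically nilpotent evolution `f` a finite memory: the value of `f x` at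
`g` depends on `x` near `g` only. Hence points with far-apart supports evolve independently, and
`0`-gluing provides sums of translates of a homoclinic point `y` along any sufficiently sparse set
of group elements.

Say that a subgroup `N` confines `y` if sums of translates of `y` along sparse subsets of `N` never
spread beyond finitely many cosets of `N`. The whole group does. If `N` confines `y`, so does the
kernel of every surjective homomorphism `N → ℤ`. Otherwise sums along the kernel reach arbitrarily
large heights, at arbitrarily late times. By residual finiteness such sums can be taken periodic
modulo a subgroup of finite index, and on periodic sums the evolution is one-dimensional: Baire's
theorem produces walls that information does not cross, so that suitable sums of bounded height are
mortal. By Baire's theorem again, some mortal sum has a neighbourhood of sums that become small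
near the identity by a common time; superposing on it a translate of a sum that reaches far at a
late time contradicts this. Since finite index is harmless, confinement descends along the
series of the group to the trivial subgroup. Then the orbit of `y` stays in the set of points
supported in a fixed finite set, and asymptotic nilpotency forces it to reach `0`.

Once homoclinic points are mortal, their density and compactness give a uniform bound on each tier.
On a single tier, finitely generated subgroups suffice: the points supported in a subgroup that
contains the memory of `f` and the gluing sets form a system over that subgroup, and they include
enough homoclinic points.
-/

open scoped Pointwise

/-! ### Compactness -/

theorem IsAsymptoticallyNilpotent.exists_uniformly_attracted {X : Type*} [MetricSpace X]
    [CompleteSpace X] {f : X → X} {o : X} (hnil : IsAsymptoticallyNilpotent o f) (hf : Continuous f)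
    {C : Set X} (hC : C.Nonempty) {ε : ℝ} (hε : 0 < ε) :
    ∃ x ∈ C, ∃ ρ > (0 : ℝ), ∃ J : ℕ, ∀ x' ∈ C, dist x' x < ρ → ∀ M ≥ J, dist (f^[M] x') o < ε := by
  have : CompleteSpace (closure C) := isClosed_closure.isComplete.completeSpace_coe
  have : Nonempty (closure C) := hC.closure.to_subtype
  let F : ℕ → Set (closure C) := fun n => ⋂ M ≥ n, {x | dist (f^[M] (x : X)) o ≤ ε / 2}
  have isClosed_F (n : ℕ) : IsClosed (F n) :=
    isClosed_biInter fun M _ => isClosed_le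
      (((hf.iterate M).comp continuous_subtype_val).dist continuous_const) continuous_const
  have iUnion_F : ⋃ n, F n = Set.univ := by
    refine Set.eq_univ_of_forall fun x => Set.mem_iUnion.mpr ?_
    obtain ⟨n, hn⟩ := Metric.tendsto_atTop.mp (hnil x) (ε / 2) (half_pos hε)
    exact ⟨n, Set.mem_iInter₂.mpr fun M hM => (hn M hM).le⟩
  obtain ⟨n, z, hz⟩ := nonempty_interior_of_iUnion_of_closed isClosed_F iUnion_F
  obtain ⟨ρ, hρ, hball⟩ := Metric.isOpen_iff.mp isOpen_interior z hz
  obtain ⟨x, hxC, hx⟩ := Metric.mem_closure_iff.mp z.2 (ρ / 2) (half_pos hρ)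
  refine ⟨x, hxC, ρ / 2, half_pos hρ, n, fun x' hx' hd M hM => ?_⟩
  have hmem : (⟨x', subset_closure hx'⟩ : closure C) ∈ F n := by
    refine interior_subset (hball ?_)
    rw [Metric.mem_ball, Subtype.dist_eq]
    linarith [dist_triangle_right x' (z : X) x]
  exact (Set.mem_iInter₂.mp hmem M hM).trans_lt (half_lt_self hε)

theorem IsAsymptoticallyNilpotent.map_zero {X : Type*} [MetricSpace X] {f : X → X} {o : X}
    (hnil : IsAsymptoticallyNilpotent o f) (hf : Continuous f) : f o = o :=
  isFixedPt_of_tendsto_iterate (hnil o) hf.continuousAt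

theorem exists_finite_expansivity_window {G X : Type*} [Group G] [MetricSpace X] [CompactSpace X]
    [MulAction G X] [ContinuousConstSMul G X] {Δ : ℝ}
    (hexp : ∀ x y : X, (∀ g : G, dist (g • x) (g • y) ≤ Δ) → x = y) {ε : ℝ} (hε : 0 < ε) :
    ∃ F : Set G, F.Finite ∧ ∀ x y : X, (∀ h ∈ F, dist (h • x) (h • y) ≤ Δ) → dist x y < ε := by
  let far : Set (X × X) := {p | ε ≤ dist p.1 p.2}
  have isCompact_far : IsCompact far :=
    (isClosed_le continuous_const (continuous_fst.dist continuous_snd)).isCompact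
  have inter_eq_empty : far ∩ ⋂ g : G, {p | dist (g • p.1) (g • p.2) ≤ Δ} = ∅ := by
    refine Set.eq_empty_of_forall_notMem fun ⟨x, y⟩ ⟨hfar, hclose⟩ => ?_
    obtain rfl : x = y := hexp x y fun g => Set.mem_iInter.mp hclose g
    exact hε.not_ge (hfar.trans_eq (dist_self x))
  obtain ⟨t, ht⟩ := isCompact_far.elim_finite_subfamily_closed _
    (fun g => isClosed_le ((continuous_fst.const_smul g).dist (continuous_snd.const_smul g))
      continuous_const) inter_eq_empty
  refine ⟨t, t.finite_toSet, fun x y h => lt_of_not_ge fun hxy => ?_⟩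
  exact Set.eq_empty_iff_forall_notMem.mp ht (x, y) ⟨hxy, Set.mem_iInter₂.mpr h⟩

/-! ### Endomorphisms with a finite memory -/

theorem disjoint_mul_of_disjoint_inv_mul {G : Type*} [Group G] {A B C : Set G}
    (h : Disjoint (A⁻¹ * B) C) : Disjoint B (A * C) := by
  refine Set.disjoint_left.mpr ?_
  rintro _ hb ⟨a, ha, c, hc, rfl⟩
  exact Set.disjoint_left.mp h ⟨a⁻¹, Set.inv_mem_inv.mpr ha, _, hb, inv_mul_cancel_left a c⟩ hc

/-- An asymptotically nilpotent endomorphism `f` of an expansive pointed system, together with a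
scale `η` such that `4 * η` is an expansivity constant, and a finite memory set `E`: knowing a point
up to `4 * η` along `E` determines its image up to `η`. -/
structure LocalEndo (G : Type u) (X : Type v) [Group G] [MetricSpace X] [MulAction G X] where
  o : X
  f : X → X
  η : ℝ
  E : Set G
  η_pos : 0 < η
  smul_o : ∀ g : G, g • o = o
  eq_of_close : ∀ x y : X, (∀ g : G, dist (g • x) (g • y) ≤ 4 * η) → x = y
  continuous_f : Continuous f
  map_smul : ∀ (g : G) (x : X), f (g • x) = g • f x
  nil : IsAsymptoticallyNilpotent o f
  finite_E : E.Finite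
  one_mem_E : (1 : G) ∈ E
  memory : ∀ x y : X, (∀ e ∈ E, dist (e • x) (e • y) ≤ 4 * η) → dist (f x) (f y) ≤ η

namespace LocalEndo

variable {G : Type u} {X : Type v} [Group G] [MetricSpace X] [MulAction G X]

theorem exists_of_expansive [CompactSpace X] [ContinuousConstSMul G X] {o : X} {f : X → X} {η : ℝ}
    (hη : 0 < η) (ho : ∀ g : G, g • o = o)
    (hexp : ∀ x y : X, (∀ g : G, dist (g • x) (g • y) ≤ 4 * η) → x = y) (hf : Continuous f)
    (hfg : ∀ (g : G) (x : X), f (g • x) = g • f x) (hnil : IsAsymptoticallyNilpotent o f) :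
    ∃ c : LocalEndo G X, c.o = o ∧ c.f = f ∧ c.η = η := by
  obtain ⟨δ, hδ, hu⟩ := Metric.uniformContinuous_iff.mp
    (CompactSpace.uniformContinuous_of_continuous hf) η hη
  obtain ⟨F, hF, hw⟩ := exists_finite_expansivity_window hexp hδ
  exact ⟨⟨o, f, η, insert 1 F, hη, ho, hexp, hf, hfg, hnil, hF.insert 1, Set.mem_insert _ _,
    fun x y h => (hu (hw x y fun e he => h e (Set.mem_insert_of_mem _ he))).le⟩, rfl, rfl, rfl⟩

variable (c : LocalEndo G X)

/-- The support of `x`: the group elements that move `x` away from the special point. -/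
def supp (x : X) : Set G := {g | c.η < dist (g • x) c.o}

/-- `x` is mortal if its orbit under `f` reaches the special point. -/
def IsMortal (x : X) : Prop := ∃ n, c.f^[n] x = c.o

/-- `x'` superposes `x` and `w`: it looks like `x` where `w` vanishes, and like `w` where `x`
vanishes. -/
def Superposes (x w x' : X) : Prop :=
  (∀ g ∉ c.supp w, dist (g • x') (g • x) ≤ 4 * c.η) ∧
    ∀ g ∉ c.supp x, dist (g • x') (g • w) ≤ 4 * c.η

variable {c}

theorem notMem_supp {x : X} {g : G} : g ∉ c.supp x ↔ dist (g • x) c.o ≤ c.η := by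
  simp [supp]

theorem mem_supp_smul {x : X} {g h : G} : g ∈ c.supp (h • x) ↔ g * h ∈ c.supp x := by
  simp [supp, mul_smul]

theorem mem_mul_supp_smul {x : X} {D : Set G} {g h : G} :
    g ∈ D * c.supp (h • x) ↔ g * h ∈ D * c.supp x := by
  simp only [Set.mem_mul, mem_supp_smul]
  refine ⟨fun ⟨d, hd, a, ha, h⟩ => ⟨d, hd, _, ha, by rw [← h, mul_assoc]⟩,
    fun ⟨d, hd, a, ha, hda⟩ => ⟨d, hd, a * h⁻¹, by simpa using ha, ?_⟩⟩
  rw [← mul_assoc, hda, mul_inv_cancel_right]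

theorem map_o : c.f c.o = c.o := c.nil.map_zero c.continuous_f

theorem iterate_o (j : ℕ) : c.f^[j] c.o = c.o := Function.iterate_fixed map_o j

theorem iterate_smul (j : ℕ) (g : G) (x : X) : c.f^[j] (g • x) = g • c.f^[j] x :=
  ((Function.Commute.iterate_left (f := c.f) (g := (g • ·)) (c.map_smul g) j) x)

theorem iterate_eq_o_of_le {x : X} {T j : ℕ} (hT : c.f^[T] x = c.o) (hj : T ≤ j) :
    c.f^[j] x = c.o := by
  obtain ⟨k, rfl⟩ := Nat.exists_eq_add_of_le' hj
  rw [Function.iterate_add_apply, hT, iterate_o]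

theorem IsMortal.smul {x : X} (hx : c.IsMortal x) (g : G) : c.IsMortal (g • x) := by
  obtain ⟨n, hn⟩ := hx
  exact ⟨n, by rw [iterate_smul, hn, c.smul_o]⟩

theorem IsMortal.of_iterate {x : X} {j : ℕ} (hx : c.IsMortal (c.f^[j] x)) : c.IsMortal x := by
  obtain ⟨n, hn⟩ := hx
  exact ⟨n + j, by rwa [Function.iterate_add_apply]⟩

theorem IsMortal.iterate {x : X} (hx : c.IsMortal x) (j : ℕ) : c.IsMortal (c.f^[j] x) := by
  obtain ⟨n, hn⟩ := hx
  exact ⟨n, by rw [← Function.iterate_add_apply, iterate_eq_o_of_le hn (Nat.le_add_right n j)]⟩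

theorem supp_o : c.supp c.o = ∅ := by
  ext g
  simpa [c.smul_o, supp] using c.η_pos.le

theorem eq_o_of_supp_eq_empty {x : X} (h : c.supp x = ∅) : x = c.o := by
  refine c.eq_of_close _ _ fun g => ?_
  have hg : dist (g • x) c.o ≤ c.η := notMem_supp.mp (h ▸ Set.notMem_empty g)
  rw [c.smul_o]
  linarith [c.η_pos]

/-! #### Propagation -/

theorem dist_smul_map_le {x y : X} {g : G}
    (h : ∀ e ∈ c.E, dist ((e * g) • x) ((e * g) • y) ≤ 4 * c.η) :
    dist (g • c.f x) (g • c.f y) ≤ c.η := by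
  rw [← c.map_smul, ← c.map_smul]
  exact c.memory _ _ fun e he => by simpa [mul_smul] using h e he

theorem finite_pow_E (j : ℕ) : (c.E ^ j).Finite := by
  induction j with
  | zero => simp
  | succ j ih => rw [pow_succ]; exact ih.mul c.finite_E

theorem pow_E_mono {i j : ℕ} (h : i ≤ j) : c.E ^ i ⊆ c.E ^ j :=
  Set.pow_subset_pow_right c.one_mem_E h

theorem dist_smul_iterate_le {x y : X} {j : ℕ} {g : G}
    (h : ∀ k ∈ c.E ^ j, dist ((k * g) • x) ((k * g) • y) ≤ 4 * c.η) :
    dist (g • c.f^[j] x) (g • c.f^[j] y) ≤ 4 * c.η := by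
  induction j generalizing g with
  | zero => simpa using h 1 (by simp)
  | succ j ih =>
    rw [Function.iterate_succ_apply', Function.iterate_succ_apply']
    refine (dist_smul_map_le fun e he => ih fun k hk => ?_).trans (by linarith [c.η_pos])
    rw [← mul_assoc]
    exact h _ (pow_succ c.E j ▸ Set.mul_mem_mul hk he)

theorem supp_map_subset (x : X) : c.supp (c.f x) ⊆ c.E⁻¹ * c.supp x := by
  refine fun g hg => by_contra fun hcon => notMem_supp.mpr ?_ hg
  have h := dist_smul_map_le (c := c) (x := x) (y := c.o) (g := g) fun e he => ?_
  · rwa [map_o, c.smul_o] at h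
  · have he' : e * g ∉ c.supp x := fun hx =>
      hcon ⟨e⁻¹, Set.inv_mem_inv.mpr he, e * g, hx, inv_mul_cancel_left e g⟩
    rw [c.smul_o]
    linarith [notMem_supp.mp he', c.η_pos]

theorem supp_iterate_subset (x : X) (j : ℕ) : c.supp (c.f^[j] x) ⊆ (c.E ^ j)⁻¹ * c.supp x := by
  induction j with
  | zero => simp
  | succ j ih =>
    rw [Function.iterate_succ_apply', pow_succ, mul_inv_rev, mul_assoc]
    exact (supp_map_subset _).trans (Set.mul_subset_mul_left ih)

theorem exists_ball_disjoint_supp [ContinuousConstSMul G X] (c : LocalEndo G X) {V : Set G}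
    (hV : V.Finite) : ∃ ρ > (0 : ℝ), ∀ x, dist x c.o < ρ → Disjoint V (c.supp x) := by
  have h : ∀ᶠ x in 𝓝 c.o, ∀ v ∈ V, dist (v • x) c.o < c.η := by
    rw [hV.eventually_all]
    intro v _
    have hv : Tendsto (fun x => v • x) (𝓝 c.o) (𝓝 (v • c.o)) := tendsto_id.const_smul v
    rw [c.smul_o] at hv
    exact Metric.tendsto_nhds.mp hv c.η c.η_pos
  obtain ⟨ρ, hρ, hball⟩ := Metric.eventually_nhds_iff.mp h
  exact ⟨ρ, hρ, fun x hx => Set.disjoint_left.mpr fun v hv => notMem_supp.mpr (hball hx v hv).le⟩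

theorem isMortal_of_supp_subset [ContinuousConstSMul G X] {x : X} {V : Set G} (hV : V.Finite)
    (h : ∀ j, c.supp (c.f^[j] x) ⊆ V * (MulAction.stabilizer G x : Set G)) : c.IsMortal x := by
  obtain ⟨ρ, hρ, hball⟩ := c.exists_ball_disjoint_supp hV
  obtain ⟨n, hn⟩ := ((Metric.tendsto_nhds.mp (c.nil x)) ρ hρ).exists
  refine ⟨n, eq_o_of_supp_eq_empty (Set.eq_empty_of_forall_notMem fun g hg => ?_)⟩
  obtain ⟨v, hv, s, hs, rfl⟩ := h n hg
  rw [← mem_supp_smul, ← iterate_smul, MulAction.mem_stabilizer_iff.mp hs] at hg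
  exact Set.disjoint_left.mp (hball _ hn) hv hg

/-! #### Superpositions -/

theorem Superposes.map {x w x' : X} (h : c.Superposes x w x')
    (hdisj : Disjoint (c.E⁻¹ * c.supp x) (c.E⁻¹ * c.supp w)) :
    c.Superposes (c.f x) (c.f w) (c.f x') := by
  have hη := c.η_pos
  have off {z : X} {g : G} (hg : g ∉ c.E⁻¹ * c.supp z) :
      (∀ e ∈ c.E, e * g ∉ c.supp z) ∧ dist (g • c.f z) c.o ≤ c.η :=
    ⟨fun e he hz => hg ⟨e⁻¹, Set.inv_mem_inv.mpr he, _, hz, inv_mul_cancel_left e g⟩,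
      notMem_supp.mp fun hz => hg (supp_map_subset z hz)⟩
  have like_x {g : G} (hg : g ∉ c.E⁻¹ * c.supp w) : dist (g • c.f x') (g • c.f x) ≤ c.η :=
    dist_smul_map_le fun e he => h.1 _ ((off hg).1 e he)
  have like_w {g : G} (hg : g ∉ c.E⁻¹ * c.supp x) : dist (g • c.f x') (g • c.f w) ≤ c.η :=
    dist_smul_map_le fun e he => h.2 _ ((off hg).1 e he)
  refine ⟨fun g hg => ?_, fun g hg => ?_⟩ <;> rw [notMem_supp] at hg
  · by_cases hw : g ∈ c.E⁻¹ * c.supp w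
    · have hx := Set.disjoint_right.mp hdisj hw
      linarith [like_w hx, (off hx).2, dist_triangle (g • c.f x') (g • c.f w) (g • c.f x),
        dist_triangle_right (g • c.f w) (g • c.f x) c.o]
    · linarith [like_x hw]
  · by_cases hx : g ∈ c.E⁻¹ * c.supp x
    · have hw := Set.disjoint_left.mp hdisj hx
      linarith [like_x hw, (off hw).2, dist_triangle (g • c.f x') (g • c.f x) (g • c.f w),
        dist_triangle_right (g • c.f x) (g • c.f w) c.o]
    · linarith [like_w hx]

theorem Superposes.iterate_eq {x w x' : X} (h : c.Superposes x w x') {T : ℕ}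
    (hdisj : Disjoint ((c.E ^ T)⁻¹ * c.supp x) ((c.E ^ T)⁻¹ * c.supp w))
    (hT : c.f^[T] x = c.o) {j : ℕ} (hj : T ≤ j) : c.f^[j] x' = c.f^[j] w := by
  have superposes_iterate : ∀ i ≤ T, c.Superposes (c.f^[i] x) (c.f^[i] w) (c.f^[i] x') := by
    intro i
    induction i with
    | zero => exact fun _ => h
    | succ i ih =>
      intro hi
      have hsub (z : X) : c.E⁻¹ * c.supp (c.f^[i] z) ⊆ (c.E ^ T)⁻¹ * c.supp z :=
        calc c.E⁻¹ * c.supp (c.f^[i] z)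
          _ ⊆ c.E⁻¹ * ((c.E ^ i)⁻¹ * c.supp z) := Set.mul_subset_mul_left (supp_iterate_subset z i)
          _ = (c.E ^ (i + 1))⁻¹ * c.supp z := by rw [pow_succ, mul_inv_rev, mul_assoc]
          _ ⊆ _ := Set.mul_subset_mul_right (Set.inv_subset_inv.mpr (pow_E_mono hi))
      simp only [Function.iterate_succ_apply']
      exact (ih (by omega)).map (hdisj.mono (hsub x) (hsub w))
  have hTw : c.f^[T] x' = c.f^[T] w := by
    refine c.eq_of_close _ _ fun g => (superposes_iterate T le_rfl).2 g ?_
    rw [hT, supp_o]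
    exact Set.notMem_empty g
  obtain ⟨k, rfl⟩ := Nat.exists_eq_add_of_le' hj
  rw [Function.iterate_add_apply, hTw, ← Function.iterate_add_apply]

/-! #### Sums of points with separated supports -/

variable (c)

/-- The `D`-neighbourhoods of the supports of the points of `P` are disjoint. -/
def Separated (D : Set G) (P : Set X) : Prop :=
  P.PairwiseDisjoint fun x => D * c.supp x

/-- `z` is a sum of the points of `P`: it is close to `x ∈ P` on the `D`-neighbourhood of the
support of `x`, and vanishes outside these neighbourhoods. -/
structure IsSum (D : Set G) (P : Set X) (z : X) : Prop where
  near : ∀ x ∈ P, ∀ g ∈ D * c.supp x, dist (g • z) (g • x) ≤ c.η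
  far : ∀ g, (∀ x ∈ P, g ∉ D * c.supp x) → dist (g • z) c.o ≤ c.η

variable {c} {D : Set G}

theorem supp_subset_mul_supp (hD : (1 : G) ∈ D) (x : X) : c.supp x ⊆ D * c.supp x :=
  fun g hg => ⟨1, hD, g, hg, one_mul g⟩

theorem Separated.eq {P : Set X} (hP : c.Separated D P) {x y : X} (hx : x ∈ P) (hy : y ∈ P) {g : G}
    (hgx : g ∈ D * c.supp x) (hgy : g ∈ D * c.supp y) : x = y :=
  hP.elim_set hx hy g hgx hgy

theorem IsSum.singleton (hD : (1 : G) ∈ D) (w : X) : c.IsSum D {w} w where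
  near := by simp [c.η_pos.le]
  far g h := notMem_supp.mp fun hg => h w rfl (supp_subset_mul_supp hD w hg)

theorem IsSum.dist_le {P P' : Set X} {z z' : X} (hz : c.IsSum D P z) (hz' : c.IsSum D P' z') {g : G}
    (h : ∀ x, g ∈ D * c.supp x → (x ∈ P ↔ x ∈ P')) : dist (g • z) (g • z') ≤ 2 * c.η := by
  by_cases hg : ∃ x ∈ P, g ∈ D * c.supp x
  · obtain ⟨x, hx, hgx⟩ := hg
    linarith [hz.near x hx g hgx, hz'.near x ((h x hgx).mp hx) g hgx,
      dist_triangle_right (g • z) (g • z') (g • x)]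
  · push Not at hg
    linarith [hz.far g hg, hz'.far g fun x hx hgx => hg x ((h x hgx).mpr hx) hgx,
      dist_triangle_right (g • z) (g • z') c.o]

theorem IsSum.unique {P : Set X} {z z' : X} (hz : c.IsSum D P z) (hz' : c.IsSum D P z') : z = z' :=
  c.eq_of_close _ _ fun g => by linarith [hz.dist_le hz' (g := g) fun _ _ => Iff.rfl, c.η_pos]

theorem IsSum.supp_subset {P : Set X} {z : X} (hz : c.IsSum D P z) :
    c.supp z ⊆ ⋃ x ∈ P, D * c.supp x := by
  intro g hg
  by_contra hcon
  simp only [Set.mem_iUnion₂, not_exists] at hcon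
  exact notMem_supp.mpr (hz.far g hcon) hg

theorem IsSum.smul {P : Set X} {z : X} (hz : c.IsSum D P z) (h : G) :
    c.IsSum D (h • P) (h • z) where
  near := by
    rintro _ ⟨x, hx, rfl⟩ g hg
    simpa only [mul_smul] using hz.near x hx _ (mem_mul_supp_smul.mp hg)
  far g hg := by
    rw [← mul_smul]
    exact hz.far _ fun x hx hgx =>
      hg _ (Set.smul_mem_smul_set hx) (mem_mul_supp_smul.mpr hgx)

theorem Separated.union {P P' : Set X} (hP : c.Separated D P) (hP' : c.Separated D P')
    (h : ∀ x ∈ P, ∀ y ∈ P', Disjoint (D * c.supp x) (D * c.supp y)) : c.Separated D (P ∪ P') :=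
  (Set.pairwiseDisjoint_union.mpr ⟨hP, hP', fun x hx y hy _ => h x hx y hy⟩)

theorem IsSum.superposes {P P' : Set X} {z z' z'' : X} (hz : c.IsSum D P z) (hz' : c.IsSum D P' z')
    (hz'' : c.IsSum D (P ∪ P') z'') : c.Superposes z z' z'' := by
  have near_first : ∀ {Q Q' : Set X} {y y' : X}, c.IsSum D Q y → c.IsSum D Q' y' →
      c.IsSum D (Q ∪ Q') z'' → ∀ g ∉ c.supp y', dist (g • z'') (g • y) ≤ 4 * c.η := by
    intro Q Q' y y' hy hy' hsum g hg
    rw [notMem_supp] at hg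
    have hη := c.η_pos
    by_cases hQ : ∃ x ∈ Q, g ∈ D * c.supp x
    · obtain ⟨x, hx, hgx⟩ := hQ
      linarith [hsum.near x (Or.inl hx) g hgx, hy.near x hx g hgx,
        dist_triangle_right (g • z'') (g • y) (g • x)]
    · push Not at hQ
      have hfar := hy.far g hQ
      have hagree := hsum.dist_le hy' (g := g) fun x hgx =>
        ⟨fun hx => hx.resolve_left fun hx' => hQ x hx' hgx, Or.inr⟩
      linarith [dist_triangle (g • z'') (g • y') c.o, dist_triangle_right (g • z'') (g • y) c.o]
  exact ⟨near_first hz hz' hz'', near_first hz' hz (Set.union_comm P P' ▸ hz'')⟩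

theorem exists_ball_isSum_pair [CompactSpace X] [ContinuousConstSMul G X] (c : LocalEndo G X)
    (hD : D.Finite) (hD₁ : 1 ∈ D) {y : X} (hy : (c.supp y).Finite) {T : ℕ} (hT : c.f^[T] y = c.o)
    {ρ : ℝ} (hρ : 0 < ρ) :
    ∃ r > (0 : ℝ), ∀ x, dist x c.o < r → c.Separated D ({y} ∪ {x}) ∧
      ∀ z, c.IsSum D ({y} ∪ {x}) z → dist z y < ρ ∧ ∀ M ≥ T, c.f^[M] z = c.f^[M] x := by
  obtain ⟨W, hW, hwin⟩ := exists_finite_expansivity_window c.eq_of_close hρ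
  have hET : (c.E ^ T).Finite := finite_pow_E T
  obtain ⟨r, hr, hball⟩ := c.exists_ball_disjoint_supp
    (V := W ∪ D⁻¹ * (D * c.supp y) ∪ ((c.E ^ T)⁻¹)⁻¹ * ((c.E ^ T)⁻¹ * c.supp y))
    ((hW.union (hD.inv.mul (hD.mul hy))).union (hET.inv.inv.mul (hET.inv.mul hy)))
  refine ⟨r, hr, fun x hx => ?_⟩
  obtain ⟨⟨hxW, hxD⟩, hxE⟩ : (Disjoint W (c.supp x) ∧ Disjoint (D⁻¹ * (D * c.supp y)) (c.supp x))
      ∧ Disjoint (((c.E ^ T)⁻¹)⁻¹ * ((c.E ^ T)⁻¹ * c.supp y)) (c.supp x) := by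
    simpa only [Set.disjoint_union_left] using hball x hx
  have hsep : c.Separated D ({y} ∪ {x}) := by
    refine .union (Set.pairwiseDisjoint_singleton _ _) (Set.pairwiseDisjoint_singleton _ _) ?_
    rintro _ rfl _ rfl
    exact disjoint_mul_of_disjoint_inv_mul hxD
  refine ⟨hsep, fun z hz => ?_⟩
  have hsup : c.Superposes y x z := (IsSum.singleton hD₁ y).superposes (.singleton hD₁ x) hz
  exact ⟨hwin z y fun h hh => hsup.1 h (Set.disjoint_left.mp hxW hh),
    fun M hM => hsup.iterate_eq (disjoint_mul_of_disjoint_inv_mul hxE) hT hM⟩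

end LocalEndo

/-! ### Sums of translates of a point of finite support -/

/-- A `LocalEndo` with a point `y` of finite support all of whose separated families of translates
have a sum, and an invariant set `S` containing these sums, all of whose separated families again
have a sum; `D` is the separation required in both cases. -/
structure SumSystem (G : Type u) (X : Type v) [Group G] [MetricSpace X] [MulAction G X] extends
    LocalEndo G X where
  y : X
  D : Set G
  S : Set X
  finite_D : D.Finite
  one_mem_D : (1 : G) ∈ D
  finite_supp_y : (toLocalEndo.supp y).Finite
  smul_mem : ∀ (g : G), ∀ x ∈ S, g • x ∈ S
  map_mem : ∀ x ∈ S, f x ∈ S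
  exists_isSum_mem : ∀ P ⊆ MulAction.orbit G y, toLocalEndo.Separated D P →
    ∃ z ∈ S, toLocalEndo.IsSum D P z
  exists_isSum : ∀ P ⊆ S, toLocalEndo.Separated D P → ∃ z, toLocalEndo.IsSum D P z

namespace SumSystem

open LocalEndo

variable {G : Type u} {X : Type v} [Group G] [MetricSpace X] [MulAction G X] (c : SumSystem G X)

/-- The region occupied by `y`; the translate `a⁻¹ • y` occupies `Q * {a}`. -/
def Q : Set G := c.D * c.supp c.y

/-- The translates `a⁻¹ • y` with `a ∈ A` occupy disjoint regions. -/
def Sparse (A : Set G) : Prop := A.PairwiseDisjoint fun a => c.Q * {a}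

/-- The translates `a⁻¹ • y` with `a ∈ A`. -/
def translates (A : Set G) : Set X := (fun a : G => a⁻¹ • c.y) '' A

open Classical in
/-- The sum in `S` of the translates `a⁻¹ • y` with `a ∈ A`; a junk value if there is none, which
does not happen for sparse `A`. -/
noncomputable def Y (A : Set G) : X :=
  if h : ∃ z ∈ c.S, c.IsSum c.D (c.translates A) z then h.choose else c.o

variable {c}

theorem finite_Q : c.Q.Finite := c.finite_D.mul c.finite_supp_y

theorem mem_Q_mul_singleton {g a : G} : g ∈ c.Q * {a} ↔ g * a⁻¹ ∈ c.Q := by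
  rw [Set.mul_singleton, Set.image_mul_right, Set.mem_preimage]

theorem mem_mul_supp_translate {g a : G} : g ∈ c.D * c.supp (a⁻¹ • c.y) ↔ g * a⁻¹ ∈ c.Q :=
  mem_mul_supp_smul

theorem Sparse.eq {A : Set G} (hA : c.Sparse A) {a b g : G} (ha : a ∈ A) (hb : b ∈ A)
    (hga : g * a⁻¹ ∈ c.Q) (hgb : g * b⁻¹ ∈ c.Q) : a = b :=
  hA.elim_set ha hb g (mem_Q_mul_singleton.mpr hga) (mem_Q_mul_singleton.mpr hgb)

theorem sparse_of_forall_eq {A : Set G}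
    (h : ∀ a ∈ A, ∀ b ∈ A, ∀ g, g * a⁻¹ ∈ c.Q → g * b⁻¹ ∈ c.Q → a = b) : c.Sparse A :=
  fun a ha b hb hne => Set.disjoint_left.mpr fun g hga hgb =>
    hne (h a ha b hb g (mem_Q_mul_singleton.mp hga) (mem_Q_mul_singleton.mp hgb))

theorem Sparse.mono {A B : Set G} (hB : c.Sparse B) (h : A ⊆ B) : c.Sparse A :=
  Set.PairwiseDisjoint.subset hB h

theorem sparse_empty : c.Sparse ∅ := Set.pairwiseDisjoint_empty

theorem sparse_singleton (g : G) : c.Sparse {g} := Set.pairwiseDisjoint_singleton _ _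

theorem Sparse.translate {A : Set G} (hA : c.Sparse A) (h : G) : c.Sparse ((· * h) ⁻¹' A) :=
  sparse_of_forall_eq fun a ha b hb g hga hgb => mul_right_cancel
    (hA.eq ha hb (g := g * h) (by simpa [mul_assoc] using hga) (by simpa [mul_assoc] using hgb))

theorem Sparse.separated {A : Set G} (hA : c.Sparse A) : c.Separated c.D (c.translates A) := by
  rintro _ ⟨a, ha, rfl⟩ _ ⟨b, hb, rfl⟩ hne
  refine Set.disjoint_left.mpr fun g hga hgb => hne ?_
  rw [hA.eq ha hb (mem_mul_supp_translate.mp hga) (mem_mul_supp_translate.mp hgb)]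

theorem iterate_mem {x : X} (hx : x ∈ c.S) (j : ℕ) : c.f^[j] x ∈ c.S :=
  Set.MapsTo.iterate c.map_mem j hx

theorem Y_spec {A : Set G} (hA : c.Sparse A) :
    c.Y A ∈ c.S ∧ c.IsSum c.D (c.translates A) (c.Y A) := by
  have h : ∃ z ∈ c.S, c.IsSum c.D (c.translates A) z :=
    c.exists_isSum_mem _ (Set.image_subset_iff.mpr fun a _ => ⟨a⁻¹, rfl⟩) hA.separated
  rw [Y, dif_pos h]
  exact h.choose_spec

theorem Y_mem {A : Set G} (hA : c.Sparse A) : c.Y A ∈ c.S := (Y_spec hA).1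

theorem isSum_Y {A : Set G} (hA : c.Sparse A) : c.IsSum c.D (c.translates A) (c.Y A) :=
  (Y_spec hA).2

theorem dist_smul_Y_le {A B : Set G} (hA : c.Sparse A) (hB : c.Sparse B) {g : G}
    (h : ∀ a, g * a⁻¹ ∈ c.Q → (a ∈ A ↔ a ∈ B)) : dist (g • c.Y A) (g • c.Y B) ≤ 2 * c.η := by
  refine (isSum_Y hA).dist_le (isSum_Y hB) fun x hx => ⟨?_, ?_⟩ <;> rintro ⟨a, ha, rfl⟩
  · exact ⟨a, (h a (mem_mul_supp_translate.mp hx)).mp ha, rfl⟩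
  · exact ⟨a, (h a (mem_mul_supp_translate.mp hx)).mpr ha, rfl⟩

theorem smul_Y {A : Set G} (hA : c.Sparse A) (h : G) : h • c.Y A = c.Y ((· * h) ⁻¹' A) := by
  refine ((isSum_Y hA).smul h).unique ?_
  convert isSum_Y (hA.translate h) using 1
  ext x
  constructor
  · rintro ⟨_, ⟨a, ha, rfl⟩, rfl⟩
    exact ⟨a * h⁻¹, by simpa using ha, by simp [mul_smul]⟩
  · rintro ⟨n, hn, rfl⟩
    exact ⟨_, ⟨n * h, hn, rfl⟩, by simp [mul_smul]⟩

theorem Y_one : c.Y {1} = c.y := by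
  refine (isSum_Y (sparse_singleton 1)).unique ?_
  simpa [translates] using IsSum.singleton c.one_mem_D c.y

theorem supp_Y_subset {A : Set G} (hA : c.Sparse A) : c.supp (c.Y A) ⊆ c.Q * A := by
  intro g hg
  obtain ⟨_, ⟨a, ha, rfl⟩, hga⟩ := Set.mem_iUnion₂.mp ((isSum_Y hA).supp_subset hg)
  exact ⟨g * a⁻¹, mem_mul_supp_translate.mp hga, a, ha, inv_mul_cancel_right g a⟩

theorem supp_iterate_Y_subset {A : Set G} (hA : c.Sparse A) (j : ℕ) :
    c.supp (c.f^[j] (c.Y A)) ⊆ (c.E ^ j)⁻¹ * c.Q * A := by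
  rw [mul_assoc]
  exact (supp_iterate_subset _ j).trans (Set.mul_subset_mul_left (supp_Y_subset hA))

theorem superposes_union {A B : Set G} (h : c.Sparse (A ∪ B)) :
    c.Superposes (c.Y A) (c.Y B) (c.Y (A ∪ B)) := by
  refine (isSum_Y (h.mono Set.subset_union_left)).superposes
    (isSum_Y (h.mono Set.subset_union_right)) ?_
  rw [translates, translates, ← Set.image_union]
  exact isSum_Y h

variable (c) in
theorem exists_window [CompactSpace X] [ContinuousConstSMul G X] {ρ : ℝ} (hρ : 0 < ρ) :
    ∃ W : Set G, W.Finite ∧ ∀ A B : Set G, c.Sparse A → c.Sparse B →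
      (∀ n ∈ W, n ∈ A ↔ n ∈ B) → dist (c.Y A) (c.Y B) < ρ := by
  obtain ⟨F, hF, hw⟩ := exists_finite_expansivity_window c.eq_of_close hρ
  refine ⟨c.Q⁻¹ * F, finite_Q.inv.mul hF, fun A B hA hB h => hw _ _ fun g hg => ?_⟩
  refine (dist_smul_Y_le hA hB fun a ha => h a ⟨(g * a⁻¹)⁻¹, by simpa using ha, g, hg, ?_⟩).trans
    (by linarith [c.η_pos])
  group

theorem exists_window_supp [CompactSpace X] [ContinuousConstSMul G X] {A : Set G} (hA : c.Sparse A)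
    {j : ℕ} {g : G} (hg : g ∈ c.supp (c.f^[j] (c.Y A))) :
    ∃ W : Set G, W.Finite ∧ ∀ B : Set G, c.Sparse B → (∀ n ∈ W, n ∈ B ↔ n ∈ A) →
      g ∈ c.supp (c.f^[j] (c.Y B)) := by
  have hopen : IsOpen {x : X | c.η < dist (g • c.f^[j] x) c.o} :=
    isOpen_lt continuous_const (((c.continuous_f.iterate j).const_smul g).dist continuous_const)
  obtain ⟨ρ, hρ, hball⟩ := Metric.isOpen_iff.mp hopen (c.Y A) hg
  obtain ⟨W, hW, h⟩ := c.exists_window hρ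
  exact ⟨W, hW, fun B hB hAB => hball (h B A hB hA hAB)⟩

end SumSystem

/-! ### Confinement to a subgroup -/

theorem exists_finite_mul_of_finiteIndex {G : Type*} [Group G] {M N : Subgroup G}
    (hfin : (M.subgroupOf N).FiniteIndex) :
    ∃ V : Set G, V.Finite ∧ V ⊆ N ∧ (N : Set G) ⊆ V * (M : Set G) := by
  obtain ⟨S, hS, -⟩ := (M.subgroupOf N).exists_isComplement_left 1
  refine ⟨(↑) '' S, hS.finite_left.image _, by rintro _ ⟨s, -, rfl⟩; exact s.2, fun n hn => ?_⟩
  obtain ⟨⟨s, m⟩, hsm⟩ := (hS.existsUnique ⟨n, hn⟩).exists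
  exact ⟨s, ⟨s, s.2, rfl⟩, m, m.2, congrArg Subtype.val hsm⟩

namespace SumSystem

open LocalEndo

variable {G : Type u} {X : Type v} [Group G] [MetricSpace X] [MulAction G X] {c : SumSystem G X}
  {N M : Subgroup G}

variable (c) in
/-- Sums over sparse subsets of `N` never leave `F * N`. -/
def ConfinesWithin (F : Set G) (N : Subgroup G) : Prop :=
  ∀ A : Set G, c.Sparse A → A ⊆ N → ∀ j, c.supp (c.f^[j] (c.Y A)) ⊆ F * (N : Set G)

variable (c) in
/-- `N` confines the system if the sums over sparse subsets of `N` never leave a fixed finite union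
of cosets of `N`. -/
def Confines (N : Subgroup G) : Prop :=
  ∃ F : Set G, F.Finite ∧ c.ConfinesWithin F N

variable (c) in
theorem confines_top : c.Confines ⊤ :=
  ⟨{1}, Set.finite_singleton 1, fun _ _ _ _ g _ => ⟨1, rfl, g, Set.mem_univ g, one_mul g⟩⟩

theorem Confines.of_finiteIndex (hN : c.Confines N) (hM : M ≤ N)
    (hfin : (M.subgroupOf N).FiniteIndex) : c.Confines M := by
  obtain ⟨F, hF, h⟩ := hN
  obtain ⟨V, hV, -, hNV⟩ := exists_finite_mul_of_finiteIndex hfin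
  refine ⟨F * V, hF.mul hV, fun A hA hAM j => (h A hA (hAM.trans hM) j).trans ?_⟩
  rw [mul_assoc]
  exact Set.mul_subset_mul_left hNV

theorem Confines.exists_fg (hN : c.Confines N) : ∃ M ≤ N, M.FG ∧ c.Confines M := by
  obtain ⟨F₀, hF₀, h⟩ := hN
  let F : Set G := F₀ ∪ c.Q
  have hF : F.Finite := hF₀.union finite_Q
  let U : Set G := N ∩ (F⁻¹ * c.E⁻¹ * F)
  have hU : U.Finite := ((hF.inv.mul c.finite_E.inv).mul hF).inter_of_right _
  have hle : Subgroup.closure U ≤ N := (Subgroup.closure_le N).mpr Set.inter_subset_left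
  refine ⟨Subgroup.closure U, hle, (Subgroup.fg_iff _).mpr ⟨U, rfl, hU⟩, F, hF, ?_⟩
  intro A hA hAM j
  induction j with
  | zero =>
    exact (supp_Y_subset hA).trans (Set.mul_subset_mul Set.subset_union_right hAM)
  | succ j ih =>
    intro g hg
    obtain ⟨φ, hφ, n, hn, hgn⟩ := h A hA (hAM.trans hle) (j + 1) hg
    rw [Function.iterate_succ_apply'] at hg
    obtain ⟨e, he, b, hb, hgb⟩ := supp_map_subset _ hg
    obtain ⟨ψ, hψ, m, hm, hbm⟩ := ih hb
    dsimp only at hgn hgb hbm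
    have hnm : n * m⁻¹ = φ⁻¹ * e * ψ := by
      rw [eq_inv_mul_of_mul_eq hgn, eq_inv_mul_of_mul_eq hbm, ← hgb]
      group
    have hU : n * m⁻¹ ∈ U := ⟨N.mul_mem hn (N.inv_mem (hle hm)), hnm ▸ Set.mul_mem_mul
      (Set.mul_mem_mul (Set.inv_mem_inv.mpr (Or.inl hφ)) he) hψ⟩
    refine ⟨φ, Or.inl hφ, n, ?_, hgn⟩
    exact (Subgroup.mul_mem_cancel_right _ (inv_mem hm)).mp (Subgroup.subset_closure hU)

theorem Confines.isMortal_y [ContinuousConstSMul G X] (h : c.Confines ⊥) : c.IsMortal c.y := by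
  obtain ⟨F, hF, h⟩ := h
  refine isMortal_of_supp_subset hF fun j => ?_
  rw [← Y_one]
  exact (h {1} (sparse_singleton 1) (by simp) j).trans (Set.mul_subset_mul_left (by simp))

end SumSystem

/-! ### Heights -/

theorem exists_forall_abs_le {α : Type*} {s : Set α} (hs : s.Finite) (φ : α → ℤ) :
    ∃ r : ℤ, 0 ≤ r ∧ ∀ a ∈ s, |φ a| ≤ r := by
  obtain ⟨r, hr⟩ := (hs.image fun a => |φ a|).bddAbove
  exact ⟨max r 0, le_max_right _ _, fun a ha => (hr ⟨a, ha, rfl⟩).trans (le_max_left _ _)⟩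

/-- A height function on `G` for a subgroup `N`: it restricts to a surjective homomorphism `N → ℤ`,
with `τ` of height one, and is equivariant for right multiplication by `N`. It is defined on all of
`G` because supports of points lie in cosets of `N` rather than in `N`. -/
structure Height {G : Type u} [Group G] (N : Subgroup G) where
  ht : G → ℤ
  τ : G
  τ_mem : τ ∈ N
  ht_τ : ht τ = 1
  ht_mul : ∀ g, ∀ n ∈ N, ht (g * n) = ht g + ht n

namespace Height

variable {G : Type u} [Group G] {N : Subgroup G} (H : Height N)

theorem ht_one : H.ht 1 = 0 := by
  have := H.ht_mul 1 1 N.one_mem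
  rw [mul_one] at this
  linarith

theorem ht_inv {n : G} (hn : n ∈ N) : H.ht n⁻¹ = -H.ht n := by
  have := H.ht_mul n⁻¹ n hn
  rw [inv_mul_cancel, ht_one] at this
  linarith

theorem ht_zpow (m : ℤ) : H.ht (H.τ ^ m) = m := by
  induction m using Int.induction_on with
  | zero => simpa using H.ht_one
  | succ i ih => rw [zpow_add_one, H.ht_mul _ _ H.τ_mem, ih, H.ht_τ]
  | pred i ih =>
    rw [zpow_sub_one, H.ht_mul _ _ (N.inv_mem H.τ_mem), ih, H.ht_inv H.τ_mem, H.ht_τ]; ring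

theorem zpow_mem (m : ℤ) : H.τ ^ m ∈ N := N.zpow_mem H.τ_mem m

theorem ht_mul_zpow (g : G) (m : ℤ) : H.ht (g * H.τ ^ m) = H.ht g + m := by
  rw [H.ht_mul _ _ (H.zpow_mem m), ht_zpow]

/-- The subgroup of the elements of `N` of height zero. -/
def ker : Subgroup G where
  carrier := {n | n ∈ N ∧ H.ht n = 0}
  mul_mem' := by
    rintro a b ⟨ha, ha0⟩ ⟨hb, hb0⟩
    exact ⟨N.mul_mem ha hb, by rw [H.ht_mul _ _ hb, ha0, hb0, add_zero]⟩
  one_mem' := ⟨N.one_mem, H.ht_one⟩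
  inv_mem' := by
    rintro a ⟨ha, ha0⟩
    exact ⟨N.inv_mem ha, by rw [H.ht_inv ha, ha0, neg_zero]⟩

theorem mem_ker {n : G} : n ∈ H.ker ↔ n ∈ N ∧ H.ht n = 0 := Iff.rfl

/-- The subgroup of the elements of `K ∩ N` of height zero, used as a group of periods. -/
def per (K : Subgroup G) : Subgroup G := H.ker ⊓ K

variable {K : Subgroup G}

theorem per_mono {L : Subgroup G} (h : L ≤ K) : H.per L ≤ H.per K := inf_le_inf_left _ h

theorem ht_mul_per (g : G) {l : G} (hl : l ∈ H.per K) : H.ht (g * l) = H.ht g := by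
  rw [H.ht_mul _ _ hl.1.1, hl.1.2, add_zero]

theorem conj_mem_per [hK : K.Normal] {l : G} (hl : l ∈ H.per K) (m : ℤ) :
    H.τ ^ m * l * (H.τ ^ m)⁻¹ ∈ H.per K := by
  refine ⟨⟨N.mul_mem (N.mul_mem (H.zpow_mem m) hl.1.1) (N.inv_mem (H.zpow_mem m)), ?_⟩,
    hK.conj_mem l hl.2 _⟩
  rw [← zpow_neg, ht_mul_zpow, H.ht_mul _ _ hl.1.1, hl.1.2, ht_zpow]
  ring

theorem exists_bound {F Ψ : Set G} (hF : F.Finite) (hΨ : Ψ.Finite) :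
    ∃ r : ℤ, 0 ≤ r ∧ ∀ ψ ∈ Ψ, ∀ g ∈ F * (N : Set G), |H.ht (ψ * g) - H.ht g| ≤ r := by
  obtain ⟨r, hr, h⟩ := exists_forall_abs_le (hΨ.prod hF) fun p => H.ht (p.1 * p.2) - H.ht p.2
  refine ⟨r, hr, ?_⟩
  rintro ψ hψ _ ⟨φ, hφ, n, hn, rfl⟩
  simpa only [← mul_assoc, H.ht_mul _ _ hn, add_sub_add_right_eq_sub] using h (ψ, φ) ⟨hψ, hφ⟩

theorem exists_disjoint_mul {F D : Set G} (hF : F.Finite) (hD : D.Finite) :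
    ∃ r : ℤ, 0 ≤ r ∧ ∀ (R : ℤ) (A B : Set G), (∀ a ∈ A, a ∈ F * (N : Set G) ∧ |H.ht a| ≤ R) →
      (∀ b ∈ B, R + r < |H.ht b|) → Disjoint (D * A) (D * B) := by
  obtain ⟨r, hr₀, hr⟩ := H.exists_bound hF (hD.inv.mul hD)
  refine ⟨r, hr₀, fun R A B hA hB => Set.disjoint_left.mpr ?_⟩
  rintro _ ⟨d, hd, a, ha, rfl⟩ ⟨d', hd', b, hb, hab⟩
  have hba : d'⁻¹ * d * a = b := by
    rw [mul_assoc, inv_mul_eq_iff_eq_mul]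
    exact hab.symm
  have hht := hr _ (Set.mul_mem_mul (Set.inv_mem_inv.mpr hd') hd) a (hA a ha).1
  rw [hba] at hht
  linarith [(hA a ha).2, hB b hb, abs_sub_abs_le_abs_sub (H.ht b) (H.ht a)]

/-- Up to `per K`, a union of finitely many cosets of `N` has finitely many elements of each
height. -/
theorem exists_decomp (K : Subgroup G) [K.Normal] [K.FiniteIndex] {F : Set G} (hF : F.Finite) :
    ∃ V : Set G, V.Finite ∧ ∀ g ∈ F * (N : Set G), ∃ v ∈ V, ∃ l ∈ H.per K,
      g = v * H.τ ^ (H.ht g - H.ht v) * l := by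
  obtain ⟨W, hW, hWker, hker⟩ := exists_finite_mul_of_finiteIndex
    (inferInstance : (K.subgroupOf H.ker).FiniteIndex)
  refine ⟨F * W, hF.mul hW, ?_⟩
  rintro _ ⟨φ, hφ, n, hn, rfl⟩
  let m := H.ht n
  have hn₀ : n * H.τ ^ (-m) ∈ H.ker :=
    ⟨N.mul_mem hn (H.zpow_mem _), by rw [ht_mul_zpow, add_neg_cancel]⟩
  obtain ⟨w, hw, l, hl, hwl⟩ := hker hn₀
  have hwl : w * l = n * H.τ ^ (-m) := hwl
  have hl' : l ∈ H.per K := ⟨(H.ker.mul_mem_cancel_left (hWker hw)).mp (hwl ▸ hn₀), hl⟩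
  refine ⟨φ * w, Set.mul_mem_mul hφ hw, _, H.conj_mem_per hl' (-m), ?_⟩
  have hm : H.ht (φ * n) - H.ht (φ * w) = m := by
    rw [H.ht_mul _ _ hn, H.ht_mul _ _ (hWker hw).1, (hWker hw).2]
    ring
  have hn : n = w * l * H.τ ^ m := by rw [hwl]; group
  dsimp only
  rw [hm, hn]
  group

end Height

/-! ### Walls -/

namespace SumSystem

open LocalEndo

variable {G : Type u} {X : Type v} [Group G] [MetricSpace X] [MulAction G X] {c : SumSystem G X}
  {N : Subgroup G} {H : Height N} {K : Subgroup G} {A B : Set G}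

variable (c H K) in
/-- The admissible configurations: the sparse subsets of `N` that are invariant under `H.per K`. -/
structure Admissible (A : Set G) : Prop where
  sparse : c.Sparse A
  subset : A ⊆ N
  mul_mem : ∀ a ∈ A, ∀ l ∈ H.per K, a * l ∈ A

namespace Admissible

theorem empty : c.Admissible H K ∅ :=
  ⟨sparse_empty, Set.empty_subset _, fun _ h => h.elim⟩

theorem mono_per {L : Subgroup G} (hA : c.Admissible H K A) (h : L ≤ K) : c.Admissible H L A :=
  ⟨hA.sparse, hA.subset, fun a ha l hl => hA.mul_mem a ha l (H.per_mono h hl)⟩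

theorem smul_Y (hA : c.Admissible H K A) {l : G} (hl : l ∈ H.per K) : l • c.Y A = c.Y A := by
  rw [SumSystem.smul_Y hA.sparse]
  congr 1
  ext n
  exact ⟨fun h => by simpa using hA.mul_mem _ h _ (inv_mem hl), fun h => hA.mul_mem _ h _ hl⟩

theorem translate [K.Normal] (hA : c.Admissible H K A) (m : ℤ) :
    c.Admissible H K ((· * H.τ ^ m) ⁻¹' A) := by
  refine ⟨hA.sparse.translate _,
    fun n hn => (N.mul_mem_cancel_right (H.zpow_mem m)).mp (hA.subset hn), fun a ha l hl => ?_⟩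
  have h := hA.mul_mem _ ha _ (H.conj_mem_per hl (-m))
  rwa [show a * H.τ ^ m * (H.τ ^ (-m) * l * (H.τ ^ (-m))⁻¹) = a * l * H.τ ^ m by group] at h

theorem inter_ht (hA : c.Admissible H K A) (I : Set ℤ) : c.Admissible H K (A ∩ H.ht ⁻¹' I) :=
  ⟨hA.sparse.mono Set.inter_subset_left, fun _ hn => hA.subset hn.1, fun a ha l hl =>
    ⟨hA.mul_mem a ha.1 l hl, by simpa only [Set.mem_preimage, H.ht_mul_per a hl] using ha.2⟩⟩

end Admissible

variable (c H) in
theorem exists_ht_gap : ∃ d : ℤ, 0 ≤ d ∧ ∀ a ∈ N, ∀ b ∈ N, ∀ g, g * a⁻¹ ∈ c.Q → g * b⁻¹ ∈ c.Q →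
    |H.ht a - H.ht b| ≤ d := by
  obtain ⟨d, hd, h⟩ := H.exists_bound (Set.finite_singleton 1) (c.finite_Q.inv.mul c.finite_Q)
  refine ⟨d, hd, fun a _ b hb g hga hgb => ?_⟩
  have hab := h _ (Set.mul_mem_mul (Set.inv_mem_inv.mpr hga) hgb) b ⟨1, rfl, b, hb, one_mul b⟩
  rwa [show (g * a⁻¹)⁻¹ * (g * b⁻¹) * b = a by group] at hab

theorem Admissible.union (hA : c.Admissible H K A) (hB : c.Admissible H K B) {d : ℤ}
    (hd : ∀ a ∈ N, ∀ b ∈ N, ∀ g, g * a⁻¹ ∈ c.Q → g * b⁻¹ ∈ c.Q → |H.ht a - H.ht b| ≤ d)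
    (hgap : ∀ a ∈ A, ∀ b ∈ B, d < |H.ht a - H.ht b|) : c.Admissible H K (A ∪ B) where
  sparse := by
    refine sparse_of_forall_eq ?_
    rintro a (ha | ha) b (hb | hb) g hga hgb
    · exact hA.sparse.eq ha hb hga hgb
    · exact absurd (hd a (hA.subset ha) b (hB.subset hb) g hga hgb) (hgap a ha b hb).not_ge
    · exact absurd (hd b (hA.subset hb) a (hB.subset ha) g hgb hga) (hgap b hb a ha).not_ge
    · exact hB.sparse.eq ha hb hga hgb
  subset := Set.union_subset hA.subset hB.subset
  mul_mem := by
    rintro a (ha | ha) l hl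
    exacts [Or.inl (hA.mul_mem a ha l hl), Or.inr (hB.mul_mem a ha l hl)]

/-! #### Mortality of periodic and of bounded evolutions -/

section Mortal

variable [ContinuousConstSMul G X] [K.Normal] [K.FiniteIndex]

theorem Admissible.isMortal_of_ht_le (hN : c.Confines N) (hA : c.Admissible H K A) {T : ℕ} {R : ℤ}
    (hR : ∀ j ≥ T, ∀ g ∈ c.supp (c.f^[j] (c.Y A)), |H.ht g| ≤ R) : c.IsMortal (c.Y A) := by
  obtain ⟨F, hF, hconf⟩ := hN
  obtain ⟨V, hV, hdec⟩ := H.exists_decomp K hF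
  obtain ⟨b, -, hb⟩ := exists_forall_abs_le hV H.ht
  refine IsMortal.of_iterate (j := T) (isMortal_of_supp_subset
    (hV.mul ((Set.finite_Icc (-(R + b)) (R + b)).image (H.τ ^ ·))) fun j g hg => ?_)
  rw [← Function.iterate_add_apply] at hg
  obtain ⟨v, hv, l, hl, hgv⟩ := hdec g (hconf A hA.sparse hA.subset _ hg)
  have hm : |H.ht g - H.ht v| ≤ R + b := by grind [hR _ (Nat.le_add_left T j) g hg, hb v hv]
  exact ⟨_, Set.mul_mem_mul hv ⟨_, abs_le.mp hm, rfl⟩, l,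
    by rw [SetLike.mem_coe, MulAction.mem_stabilizer_iff, ← iterate_smul, hA.smul_Y hl], hgv.symm⟩

theorem Admissible.isMortal_of_periodic (hN : c.Confines N) (hA : c.Admissible H K A) {p : ℤ}
    (hp : 0 < p) (hper : (· * H.τ ^ p) ⁻¹' A = A) : c.IsMortal (c.Y A) := by
  obtain ⟨F, hF, hconf⟩ := hN
  obtain ⟨V, hV, hdec⟩ := H.exists_decomp K hF
  refine isMortal_of_supp_subset (hV.mul ((Set.finite_Ico 0 p).image (H.τ ^ ·))) fun j g hg => ?_
  obtain ⟨v, hv, l, hl, hgv⟩ := hdec g (hconf A hA.sparse hA.subset j hg)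
  let m := H.ht g - H.ht v
  have hτ : H.τ ^ p ∈ MulAction.stabilizer G (c.Y A) := by
    rw [MulAction.mem_stabilizer_iff, SumSystem.smul_Y hA.sparse, hper]
  refine ⟨v * H.τ ^ (m % p), Set.mul_mem_mul hv ⟨m % p, ⟨Int.emod_nonneg _ hp.ne',
    Int.emod_lt_of_pos _ hp⟩, rfl⟩, (H.τ ^ p) ^ (m / p) * l,
    Subgroup.mul_mem _ (zpow_mem hτ _) (hA.smul_Y hl), ?_⟩
  calc v * H.τ ^ (m % p) * ((H.τ ^ p) ^ (m / p) * l)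
    _ = v * (H.τ ^ (m % p) * H.τ ^ (p * (m / p))) * l := by rw [zpow_mul]; group
    _ = g := by rw [← zpow_add, Int.emod_add_mul_ediv, ← hgv]

end Mortal


/-! #### Walls -/

section Wall

variable {F : Set G}

variable (H) in
/-- `A` and `B` have the same elements in `N` at the heights within `q` of `u`. -/
def AgreeNear (u q : ℤ) (A B : Set G) : Prop :=
  ∀ n ∈ N, |H.ht n - u| ≤ q → (n ∈ A ↔ n ∈ B)

variable (c H K) in
/-- The part of `A` at the heights within `q` of `u` is a wall: it determines the evolution in
`F * N` at the heights within `r` of `u`. -/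
def IsWall (F : Set G) (u r q : ℤ) (A : Set G) : Prop :=
  ∀ B B', c.Admissible H K B → c.Admissible H K B' → AgreeNear H u q B A → AgreeNear H u q B' A →
    ∀ j, ∀ g ∈ F * (N : Set G), |H.ht g - u| ≤ r →
      dist (g • c.f^[j] (c.Y B)) (g • c.f^[j] (c.Y B')) ≤ 4 * c.η

theorem mul_zpow_mem {g : G} (hg : g ∈ F * (N : Set G)) (m : ℤ) :
    g * H.τ ^ m ∈ F * (N : Set G) := by
  obtain ⟨φ, hφ, n, hn, rfl⟩ := hg
  exact ⟨φ, hφ, _, N.mul_mem hn (H.zpow_mem m), (mul_assoc _ _ _).symm⟩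

theorem AgreeNear.translate {u q : ℤ} (h : AgreeNear H u q A B) (m : ℤ) :
    AgreeNear H (u - m) q ((· * H.τ ^ m) ⁻¹' A) ((· * H.τ ^ m) ⁻¹' B) := fun n hn hnu =>
  h _ (N.mul_mem hn (H.zpow_mem m)) (by rw [H.ht_mul_zpow]; grind)

theorem IsWall.congr {u r q : ℤ} (hA : c.IsWall H K F u r q A) (hBA : AgreeNear H u q B A) :
    c.IsWall H K F u r q B := fun C C' hC hC' h h' =>
  hA C C' hC hC' (fun n hn hnu => (h n hn hnu).trans (hBA n hn hnu))
    fun n hn hnu => (h' n hn hnu).trans (hBA n hn hnu)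

theorem IsWall.translate [K.Normal] {u r q : ℤ} (hA : c.IsWall H K F u r q A) (m : ℤ) :
    c.IsWall H K F (u + m) r q ((· * H.τ ^ (-m)) ⁻¹' A) := by
  have untranslate {B : Set G} (h : AgreeNear H (u + m) q B ((· * H.τ ^ (-m)) ⁻¹' A)) :
      AgreeNear H u q ((· * H.τ ^ m) ⁻¹' B) A := by
    have := h.translate m
    simpa only [add_sub_cancel_right, Set.preimage_preimage, zpow_neg, mul_inv_cancel_right,
      Set.preimage_id'] using this
  intro B B' hB hB' h h' j g hg hgu
  have := hA _ _ (hB.translate m) (hB'.translate m) (untranslate h) (untranslate h') j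
    (g * H.τ ^ (-m)) (mul_zpow_mem hg _) (by rw [H.ht_mul_zpow]; grind)
  rwa [← SumSystem.smul_Y hB.sparse, ← SumSystem.smul_Y hB'.sparse, iterate_smul, iterate_smul,
    smul_smul, smul_smul, mul_assoc, ← zpow_add, neg_add_cancel, zpow_zero, mul_one] at this

theorem dist_smul_iterate_Y_le {j : ℕ} {s : ℤ}
    (hs : ∀ ψ ∈ c.Q⁻¹ * c.E ^ j, ∀ g ∈ F * (N : Set G), |H.ht (ψ * g) - H.ht g| ≤ s)
    (hA : c.Admissible H K A) (hB : c.Admissible H K B) {g : G} (hg : g ∈ F * (N : Set G))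
    (h : AgreeNear H (H.ht g) s A B) :
    dist (g • c.f^[j] (c.Y A)) (g • c.f^[j] (c.Y B)) ≤ 4 * c.η := by
  refine dist_smul_iterate_le fun k hk =>
    (dist_smul_Y_le hA.sparse hB.sparse fun a ha => ?_).trans (by linarith [c.η_pos])
  by_cases haN : a ∈ N
  · refine h a haN ?_
    have := hs ((k * g * a⁻¹)⁻¹ * k) (Set.mul_mem_mul (Set.inv_mem_inv.mpr ha) hk) g hg
    rwa [show (k * g * a⁻¹)⁻¹ * k * g = a by group] at this
  · exact iff_of_false (fun h => haN (hA.subset h)) fun h => haN (hB.subset h)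

theorem exists_uniformly_vanishing [CompactSpace X] [ContinuousConstSMul G X] [K.Normal]
    [K.FiniteIndex] (hF : F.Finite) (r : ℤ) :
    ∃ (A₀ : Set G) (q : ℤ) (J : ℕ), c.Admissible H K A₀ ∧ ∀ A, c.Admissible H K A →
      AgreeNear H 0 q A A₀ → ∀ j ≥ J, ∀ g ∈ F * (N : Set G), |H.ht g| ≤ r →
        g ∉ c.supp (c.f^[j] (c.Y A)) := by
  obtain ⟨V, hV, hdec⟩ := H.exists_decomp K hF
  obtain ⟨b, -, hb⟩ := exists_forall_abs_le hV H.ht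
  obtain ⟨ε, hε, hball⟩ := c.exists_ball_disjoint_supp
    (hV.mul ((Set.finite_Icc (-(r + b)) (r + b)).image (H.τ ^ ·)))
  obtain ⟨_, ⟨A₀, hA₀, rfl⟩, ρ, hρ, J, hvanish⟩ := c.nil.exists_uniformly_attracted c.continuous_f
    (C := c.Y '' {A | c.Admissible H K A}) ⟨_, ∅, Admissible.empty, rfl⟩ hε
  obtain ⟨W, hW, hwin⟩ := c.exists_window hρ
  obtain ⟨q, -, hq⟩ := exists_forall_abs_le hW H.ht
  refine ⟨A₀, q, J, hA₀, fun A hA hAA₀ j hj g hg hgr hsupp => ?_⟩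
  have hclose : dist (c.Y A) (c.Y A₀) < ρ := hwin A A₀ hA.sparse hA₀.sparse fun n hn => by
    by_cases hnN : n ∈ N
    · exact hAA₀ n hnN (by simpa using hq n hn)
    · exact iff_of_false (fun h => hnN (hA.subset h)) fun h => hnN (hA₀.subset h)
  obtain ⟨v, hv, l, hl, hgv⟩ := hdec g hg
  rw [hgv, ← mem_supp_smul, ← iterate_smul, hA.smul_Y hl] at hsupp
  have hm : |H.ht g - H.ht v| ≤ r + b := by grind [hb v hv]
  exact Set.disjoint_left.mp (hball _ (hvanish _ ⟨A, hA, rfl⟩ hclose j hj))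
    (Set.mul_mem_mul hv ⟨_, abs_le.mp hm, rfl⟩) hsupp

theorem exists_isWall [CompactSpace X] [ContinuousConstSMul G X] [K.Normal] [K.FiniteIndex]
    (hF : F.Finite) (r : ℤ) :
    ∃ (A₀ : Set G) (q : ℤ), c.Admissible H K A₀ ∧ c.IsWall H K F 0 r q A₀ := by
  obtain ⟨A₀, q, J, hA₀, hvanish⟩ := c.exists_uniformly_vanishing (H := H) (K := K) hF r
  obtain ⟨s, -, hs⟩ := H.exists_bound hF (c.finite_Q.inv.mul (c.finite_pow_E J))
  refine ⟨A₀, max q (r + s), hA₀, fun A B hA hB hAA₀ hBA₀ j g hg hgr => ?_⟩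
  rcases le_or_gt J j with hj | hj
  · rw [sub_zero] at hgr
    have hgA := hvanish A hA (fun n hn hnq => hAA₀ n hn (hnq.trans (le_max_left _ _))) j hj g hg hgr
    have hgB := hvanish B hB (fun n hn hnq => hBA₀ n hn (hnq.trans (le_max_left _ _))) j hj g hg hgr
    rw [notMem_supp] at hgA hgB
    linarith [c.η_pos, dist_triangle_right (g • c.f^[j] (c.Y A)) (g • c.f^[j] (c.Y B)) c.o]
  · have hEJ : c.Q⁻¹ * c.E ^ j ⊆ c.Q⁻¹ * c.E ^ J := Set.mul_subset_mul_left (pow_E_mono hj.le)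
    refine dist_smul_iterate_Y_le (fun ψ hψ => hs ψ (hEJ hψ)) hA hB hg fun n hn hng => ?_
    have hn0 : |H.ht n - 0| ≤ max q (r + s) := by grind
    exact (hAA₀ n hn hn0).trans (hBA₀ n hn hn0).symm

theorem Admissible.exists_periodic [K.Normal] {A₀ : Set G} (hA₀ : c.Admissible H K A₀) (q : ℤ) :
    ∃ p > 0, ∃ B, c.Admissible H K B ∧ (∀ k : ℤ, (· * H.τ ^ (p * k)) ⁻¹' B = B) ∧
      AgreeNear H 0 q B A₀ := by
  obtain ⟨d, hd, hgap⟩ := c.exists_ht_gap H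
  let p := 2 * |q| + d + 1
  have hp : 2 * |q| + d < p := lt_add_one _
  have hp₀ : 0 < p := lt_of_le_of_lt (by positivity) hp
  have eq_of_near {a b k k' : ℤ} (hak : |a - p * k| ≤ q) (hbk : |b - p * k'| ≤ q)
      (hab : |a - b| ≤ d) : k = k' := by
    have h : |p * (k - k')| < p * 1 := by
      rw [mul_sub]
      grind
    rw [abs_mul, abs_of_pos hp₀] at h
    exact sub_eq_zero.mp (Int.abs_lt_one_iff.mp (lt_of_mul_lt_mul_left h hp₀.le))
  refine ⟨p, hp₀, {n | n ∈ N ∧ ∃ k, |H.ht n - p * k| ≤ q ∧ n * H.τ ^ (-(p * k)) ∈ A₀},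
    ⟨sparse_of_forall_eq ?_, fun n hn => hn.1, ?_⟩, fun k₀ => ?_, ?_⟩
  · rintro a ⟨haN, k, hak, ha⟩ b ⟨hbN, k', hbk, hb⟩ g hga hgb
    obtain rfl := eq_of_near hak hbk (hgap a haN b hbN g hga hgb)
    exact mul_right_cancel (hA₀.sparse.eq ha hb (g := g * H.τ ^ (-(p * k))) (by simpa using hga)
      (by simpa using hgb))
  · rintro n ⟨hn, k, hnk, hnA⟩ l hl
    exact ⟨N.mul_mem hn hl.1.1, k, by rwa [H.ht_mul_per n hl],
      (hA₀.translate (-(p * k))).mul_mem n hnA l hl⟩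
  · ext n
    have hN : n * H.τ ^ (p * k₀) ∈ N ↔ n ∈ N := N.mul_mem_cancel_right (H.zpow_mem _)
    constructor
    · rintro ⟨hn, k, hnk, hnA⟩
      refine ⟨hN.mp hn, k - k₀, ?_, ?_⟩
      · rwa [H.ht_mul_zpow, show H.ht n + p * k₀ - p * k = H.ht n - p * (k - k₀) by ring] at hnk
      · rwa [mul_assoc, ← zpow_add, show p * k₀ + -(p * k) = -(p * (k - k₀)) by ring] at hnA
    · rintro ⟨hn, k, hnk, hnA⟩
      refine ⟨hN.mpr hn, k + k₀, ?_, ?_⟩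
      · rwa [H.ht_mul_zpow, show H.ht n + p * k₀ - p * (k + k₀) = H.ht n - p * k by ring]
      · rwa [mul_assoc, ← zpow_add, show p * k₀ + -(p * (k + k₀)) = -(p * k) by ring]
  · refine fun n hn hnq => ⟨?_, fun h => ⟨hn, 0, by simpa using hnq, by simpa using h⟩⟩
    rintro ⟨-, k, hnk, hnA⟩
    obtain rfl := eq_of_near hnk (k' := 0) (by simpa using hnq) (by simpa using hd)
    simpa using hnA

theorem dist_smul_iterate_Y_le_of_isWall (hF : c.ConfinesWithin F N)
    {L M q r s : ℤ} (hr : ∀ e ∈ c.E, ∀ g ∈ F * (N : Set G), |H.ht (e * g) - H.ht g| ≤ r)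
    (hs : ∀ ψ ∈ c.Q⁻¹ * c.E ^ 0, ∀ g ∈ F * (N : Set G), |H.ht (ψ * g) - H.ht g| ≤ s)
    (hwall : c.IsWall H K F M r q B) (hwall' : c.IsWall H K F (-M) r q B) (hA : c.Admissible H K A)
    (hB : c.Admissible H K B) (hAB : ∀ n ∈ N, L ≤ |H.ht n| → (n ∈ A ↔ n ∈ B)) (hq : L + q ≤ M)
    (hsM : L + s ≤ M) (j : ℕ) {g : G} (hg : g ∈ F * (N : Set G)) (hgM : M ≤ |H.ht g|) :
    dist (g • c.f^[j] (c.Y A)) (g • c.f^[j] (c.Y B)) ≤ 4 * c.η := by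
  induction j generalizing g with
  | zero =>
    exact dist_smul_iterate_Y_le hs hA hB hg fun n hn hng => hAB n hn (by grind)
  | succ j ih =>
    by_cases hgr : |H.ht g| ≤ M + r
    · rcases le_total 0 (H.ht g)
      · exact hwall A B hA hB (fun n hn hnu => hAB n hn (by grind)) (fun _ _ _ => Iff.rfl) _ g hg
          (by grind)
      · exact hwall' A B hA hB (fun n hn hnu => hAB n hn (by grind)) (fun _ _ _ => Iff.rfl) _ g hg
          (by grind)
    · rw [Function.iterate_succ_apply', Function.iterate_succ_apply']
      refine (dist_smul_map_le fun e he => ?_).trans (by linarith [c.η_pos])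
      by_cases heg : e * g ∈ F * (N : Set G)
      · exact ih heg (by grind [hr e he g hg])
      · have hegA := notMem_supp.mp fun h => heg (hF A hA.sparse hA.subset j h)
        have hegB := notMem_supp.mp fun h => heg (hF B hB.sparse hB.subset j h)
        linarith [c.η_pos, dist_triangle_right ((e * g) • c.f^[j] (c.Y A))
          ((e * g) • c.f^[j] (c.Y B)) c.o]

theorem exists_isWall_of_periodic [CompactSpace X] [ContinuousConstSMul G X] [K.Normal]
    [K.FiniteIndex] (hF : F.Finite) (r : ℤ) :
    ∃ p > 0, ∃ q B, c.Admissible H K B ∧ (∀ k : ℤ, (· * H.τ ^ (p * k)) ⁻¹' B = B) ∧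
      ∀ k, c.IsWall H K F (p * k) r q B := by
  obtain ⟨A₀, q, hA₀, hwall⟩ := c.exists_isWall (H := H) (K := K) hF r
  obtain ⟨p, hp, B, hB, hper, hBA₀⟩ := hA₀.exists_periodic q
  refine ⟨p, hp, q, B, hB, hper, fun k => ?_⟩
  simpa only [zero_add, ← mul_neg, hper] using (hwall.congr hBA₀).translate (p * k)

/-- Far away from the heights of interest, a bounded configuration is continued by a periodic mortal
one that consists of walls. From the time on at which the latter dies, the evolution of the combined
configuration is confined between two of these walls. -/
theorem exists_bounded_alteration [CompactSpace X] [ContinuousConstSMul G X]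
    (hN : c.Confines N) (H : Height N) (K : Subgroup G) [K.Normal] [K.FiniteIndex] :
    ∃ T : ℕ, ∀ A, c.Admissible H K A → ∀ R : ℤ, (∀ a ∈ A, |H.ht a| ≤ R) → ∀ m : ℤ,
      ∃ C, c.Admissible H K C ∧ (∀ n, |H.ht n| ≤ m → (n ∈ C ↔ n ∈ A)) ∧
        ∃ R' : ℤ, ∀ j ≥ T, ∀ g ∈ c.supp (c.f^[j] (c.Y C)), |H.ht g| ≤ R' := by
  have ⟨F, hF, hconf⟩ := hN
  obtain ⟨r, hr₀, hr⟩ := H.exists_bound hF c.finite_E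
  obtain ⟨s, -, hs⟩ := H.exists_bound hF (c.finite_Q.inv.mul (c.finite_pow_E 0))
  obtain ⟨d, hd, hgap⟩ := c.exists_ht_gap H
  obtain ⟨p, hp, q, B, hB, hper, hwall⟩ := c.exists_isWall_of_periodic (H := H) (K := K) hF r
  obtain ⟨T, hT⟩ := hB.isMortal_of_periodic hN hp (by simpa using hper 1)
  refine ⟨T + 1, fun A hA R hR m => ?_⟩
  let L := max (R + d) m + 1
  obtain ⟨k, hk⟩ : ∃ k, L + max q s ≤ p * k :=
    ⟨|L + max q s|, (le_abs_self _).trans (le_mul_of_one_le_left (abs_nonneg _) hp)⟩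
  have hC : c.Admissible H K (A ∪ B ∩ H.ht ⁻¹' {v | L ≤ |v|}) :=
    hA.union (hB.inter_ht _) hgap fun a ha b hb => by grind
  refine ⟨_, hC, fun n hn => by grind, p * k + r, fun j hj g hg => ?_⟩
  by_contra! hgM
  have hlike := dist_smul_iterate_Y_le_of_isWall hconf hr hs (hwall k)
    (mul_neg p k ▸ hwall (-k)) hC hB (L := L) (fun n _ hnL => by grind) (by grind) (by grind)
  obtain ⟨i, rfl⟩ : ∃ i, j = i + 1 := ⟨j - 1, by omega⟩
  have hgF := hconf _ hC.sparse hC.subset _ hg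
  refine notMem_supp.mpr ?_ hg
  rw [Function.iterate_succ_apply', ← c.smul_o g, ← c.map_o]
  refine dist_smul_map_le fun e he => ?_
  by_cases heg : e * g ∈ F * (N : Set G)
  · have := hlike i heg (by grind [hr e he g hgF])
    rwa [iterate_eq_o_of_le hT (by omega)] at this
  · rw [c.smul_o]
    linarith [c.η_pos, notMem_supp.mp fun h => heg (hconf _ hC.sparse hC.subset i h)]

end Wall

end SumSystem

/-! ### Descent to the kernel -/

theorem exists_normal_finiteIndex_of_residuallyFinite {G : Type*} [Group G]
    [Group.ResiduallyFinite G] (K₀ : Subgroup G) [hn : K₀.Normal] [hi : K₀.FiniteIndex] {Z : Set G}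
    (hZ : Z.Finite) : ∃ K ≤ K₀, K.Normal ∧ K.FiniteIndex ∧ ∀ z ∈ Z, z ∈ K → z = 1 := by
  induction Z, hZ using Set.Finite.induction_on with
  | empty => exact ⟨K₀, le_rfl, hn, hi, fun _ h => h.elim⟩
  | @insert a Z _ _ ih =>
    obtain ⟨K, hK, _, _, h⟩ := ih
    by_cases ha : a = 1
    · exact ⟨K, hK, ‹_›, ‹_›, by simpa [ha] using h⟩
    · obtain ⟨L, hL⟩ := Group.exists_finiteIndexNormalSubgroup_notMem a ha
      have := L.isNormal'
      have := L.isFiniteIndex'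
      refine ⟨K ⊓ L.toSubgroup, inf_le_left.trans hK, inferInstance, inferInstance, ?_⟩
      rintro z (rfl | hz) hzK
      exacts [absurd hzK.2 hL, h z hz hzK.1]

/-- A point `x₀` around which `V` is uniformly cleared absorbs a far-off perturbation `w`: once `x₀`
is dead, `w` evolves as the superposition does. -/
theorem LocalEndo.exists_eventually_disjoint_supp_of_superposes {G : Type u} {X : Type v} [Group G]
    [MetricSpace X] [MulAction G X] [CompactSpace X] [ContinuousConstSMul G X] {c : LocalEndo G X}
    {N : Subgroup G} (H : Height N) {F V : Set G} (hF : F.Finite) (hV : V.Finite) {𝒞 : Set X}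
    (h𝒞 : 𝒞.Nonempty) (hmortal : ∀ x ∈ 𝒞, c.IsMortal x)
    (hbdd : ∀ x ∈ 𝒞, ∃ R, ∀ g ∈ c.supp x, g ∈ F * (N : Set G) ∧ |H.ht g| ≤ R) :
    ∃ x₀ ∈ 𝒞, ∃ (R : ℤ) (J : ℕ), ∀ w x', c.Superposes x₀ w x' → (∀ g ∈ c.supp w, R < |H.ht g|) →
      ∀ j ≥ J, c.f^[j] x' = c.f^[j] w ∧ (x' ∈ 𝒞 → Disjoint V (c.supp (c.f^[j] w))) := by
  obtain ⟨ε, hε, hball⟩ := c.exists_ball_disjoint_supp hV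
  obtain ⟨x₀, hx₀, ρ, hρ, J, hvanish⟩ := c.nil.exists_uniformly_attracted c.continuous_f h𝒞 hε
  obtain ⟨T, hT⟩ := hmortal x₀ hx₀
  obtain ⟨R₀, hR₀⟩ := hbdd x₀ hx₀
  obtain ⟨W, hW, hwin⟩ := exists_finite_expansivity_window c.eq_of_close hρ
  obtain ⟨q, -, hq⟩ := exists_forall_abs_le hW H.ht
  obtain ⟨r, -, hr⟩ := H.exists_disjoint_mul hF (c.finite_pow_E T).inv
  refine ⟨x₀, hx₀, max q (R₀ + r), max J T, fun w x' hsup hw j hj => ?_⟩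
  have heq : c.f^[j] x' = c.f^[j] w := hsup.iterate_eq
    (hr R₀ _ _ hR₀ fun b hb => (le_max_right _ _).trans_lt (hw b hb)) hT (le_of_max_le_right hj)
  have hclose : dist x' x₀ < ρ := hwin _ _ fun g hg =>
    hsup.1 g fun hgw => (hw g hgw).not_ge ((hq g hg).trans (le_max_left _ _))
  exact ⟨heq, fun hx' => heq ▸ hball _ (hvanish x' hx' hclose j (le_of_max_le_left hj))⟩

namespace SumSystem

variable {G : Type u} {X : Type v} [Group G] [MetricSpace X] [MulAction G X] {c : SumSystem G X}
  {N : Subgroup G} {H : Height N} {K : Subgroup G} {A : Set G}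

open LocalEndo

variable (c H) in
theorem exists_ht_spread (n : ℕ) : ∃ r : ℤ, 0 ≤ r ∧ ∀ {A : Set G}, c.Sparse A → A ⊆ N →
    ∀ {j}, j ≤ n → ∀ {g}, g ∈ c.supp (c.f^[j] (c.Y A)) → ∃ a ∈ A, |H.ht g - H.ht a| ≤ r := by
  obtain ⟨r, hr₀, hr⟩ := H.exists_bound (Set.finite_singleton 1)
    ((c.finite_pow_E n).inv.mul c.finite_Q)
  refine ⟨r, hr₀, fun {A} hA hAN j hj g hg => ?_⟩
  obtain ⟨ω, ⟨k, hk, q, hq, rfl⟩, a, ha, rfl⟩ := supp_iterate_Y_subset hA j hg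
  exact ⟨a, ha, hr _ (Set.mul_mem_mul (Set.inv_subset_inv.mpr (pow_E_mono hj) hk) hq) a
    ⟨1, rfl, a, hAN ha, one_mul a⟩⟩

theorem exists_far_survivor_of_not_confines_ker {F : Set G} (hF : F.Finite)
    (hconf : c.ConfinesWithin F N) (hcon : ¬c.Confines H.ker) :
    ∃ V : Set G, V.Finite ∧ ∀ (R : ℤ) (J : ℕ), ∃ A, c.Sparse A ∧ A ⊆ N ∧
      (∃ m, R < |m| ∧ ∀ a ∈ A, H.ht a = m) ∧ ∃ j ≥ J, ¬Disjoint V (c.supp (c.f^[j] (c.Y A))) := by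
  obtain ⟨V, hV, hdec⟩ := H.exists_decomp ⊤ hF
  obtain ⟨b, hb₀, hb⟩ := exists_forall_abs_le hV H.ht
  refine ⟨V, hV, fun R J => ?_⟩
  obtain ⟨r, hr₀, spread⟩ := c.exists_ht_spread H J
  obtain ⟨A, hA, hAker, j, v, hv, m, hm, hvm⟩ : ∃ A, c.Sparse A ∧ A ⊆ H.ker ∧ ∃ j, ∃ v ∈ V,
      ∃ m : ℤ, |R| + r + b < |m| ∧ v * H.τ ^ m ∈ c.supp (c.f^[j] (c.Y A)) := by
    by_contra! hbdd
    refine hcon ⟨V * (H.τ ^ ·) '' Set.Icc (-(|R| + r + b)) (|R| + r + b),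
      hV.mul ((Set.finite_Icc _ _).image _), fun A hA hAker j g hg => ?_⟩
    obtain ⟨v, hv, l, hl, hgv⟩ := hdec g (hconf A hA (hAker.trans fun _ h => h.1) j hg)
    refine ⟨_, Set.mul_mem_mul hv ⟨H.ht g - H.ht v, abs_le.mp (not_lt.mp fun hlt => ?_), rfl⟩, l,
      hl.1, hgv.symm⟩
    refine hbdd _ (hA.translate l) (fun n hn => (H.ker.mul_mem_cancel_right hl.1).mp (hAker hn)) j
      v hv _ hlt ?_
    rwa [← smul_Y hA, iterate_smul, mem_supp_smul, ← hgv]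
  refine ⟨(· * H.τ ^ m) ⁻¹' A, hA.translate _,
    fun n hn => (N.mul_mem_cancel_right (H.zpow_mem m)).mp (hAker hn).1,
    ⟨-m, ?_, fun n hn => ?_⟩, j, ?_, Set.not_disjoint_iff.mpr ⟨v, hv, ?_⟩⟩
  · rw [abs_neg]
    linarith [le_abs_self R]
  · have := (hAker hn).2
    rw [H.ht_mul_zpow] at this
    exact eq_neg_of_add_eq_zero_left this
  · by_contra! hj
    obtain ⟨a, ha, hle⟩ := spread hA (hAker.trans fun _ h => h.1) hj.le hvm
    rw [(hAker ha).2, H.ht_mul_zpow, sub_zero] at hle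
    have := abs_sub (H.ht v + m) (H.ht v)
    rw [add_sub_cancel_left] at this
    linarith [hb v hv, abs_nonneg R]
  · rwa [← smul_Y hA, iterate_smul, mem_supp_smul]

theorem exists_mul_zpow_mem_supp_iterate [ContinuousConstSMul G X] [K.Normal] [K.FiniteIndex]
    {F : Set G} (hF : F.Finite) (hconf : c.ConfinesWithin F N) (hA : c.Admissible H K A) {R : ℤ}
    (hR : ∀ a ∈ A, |H.ht a| ≤ R) (hcon : ¬c.IsMortal (c.Y A)) :
    ∃ V : Set G, V.Finite ∧ ∀ (B : ℤ) (J : ℕ), ∃ j ≥ J, ∃ v ∈ V, ∃ m : ℤ, B < |m| ∧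
      v * H.τ ^ m ∈ c.supp (c.f^[j] (c.Y A)) := by
  obtain ⟨V, hV, hdec⟩ := H.exists_decomp K hF
  obtain ⟨b, hb₀, hb⟩ := exists_forall_abs_le hV H.ht
  refine ⟨V, hV, fun B J => ?_⟩
  obtain ⟨r, hr₀, spread⟩ := c.exists_ht_spread H J
  obtain ⟨j, g, hg, hgR⟩ : ∃ j, ∃ g ∈ c.supp (c.f^[j] (c.Y A)), |B| + |R| + r + b < |H.ht g| := by
    by_contra! hle
    exact hcon (hA.isMortal_of_ht_le ⟨F, hF, hconf⟩ (T := 0) fun j _ => hle j)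
  have hj : J < j := by
    by_contra! hle
    obtain ⟨a, ha, hga⟩ := spread hA.sparse hA.subset hle hg
    grind [hR a ha]
  obtain ⟨v, hv, l, hl, hgv⟩ := hdec g (hconf A hA.sparse hA.subset j hg)
  refine ⟨j, hj.le, v, hv, H.ht g - H.ht v, by grind [hb v hv], ?_⟩
  rwa [hgv, ← mem_supp_smul, ← iterate_smul, hA.smul_Y hl] at hg

section Descent

variable [CompactSpace X] [ContinuousConstSMul G X]

theorem exists_far_survivor [K.Normal] [K.FiniteIndex] {F : Set G} (hF : F.Finite)
    (hconf : c.ConfinesWithin F N) (hA : c.Admissible H K A) {R : ℤ} (hR : ∀ a ∈ A, |H.ht a| ≤ R)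
    (hcon : ¬c.IsMortal (c.Y A)) :
    ∃ V : Set G, V.Finite ∧ ∀ (R₂ : ℤ) (J : ℕ), ∃ w ∈ c.S, c.IsMortal w ∧
      (∀ g ∈ c.supp w, g ∈ F * (N : Set G) ∧ R₂ < |H.ht g|) ∧
        (∃ R₃, ∀ g ∈ c.supp w, |H.ht g| ≤ R₃) ∧ ∃ j ≥ J, ¬Disjoint V (c.supp (c.f^[j] w)) := by
  have hN : c.Confines N := ⟨F, hF, hconf⟩
  obtain ⟨T, halter⟩ := exists_bounded_alteration hN H K
  obtain ⟨V, hV, hunbounded⟩ := exists_mul_zpow_mem_supp_iterate hF hconf hA hR hcon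
  refine ⟨V, hV, fun R₂ J => ?_⟩
  obtain ⟨r, hr₀, spread⟩ := c.exists_ht_spread H (T + J)
  obtain ⟨j, hj, v, hv, m, hm, hg⟩ := hunbounded (|R₂| + |R| + r) (T + J)
  obtain ⟨W, hW, hsurvive⟩ := exists_window_supp hA.sparse hg
  obtain ⟨b', hb'₀, hb'⟩ := exists_forall_abs_le hW H.ht
  obtain ⟨C, hC, hCA, R₃, hR₃⟩ := halter A hA R hR (|R₂| + |m| + r + b')
  have hsupp {g : G} (hg : g ∈ c.supp (H.τ ^ m • c.f^[T] (c.Y C))) :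
      g * H.τ ^ m ∈ c.supp (c.f^[T] (c.Y C)) := mem_supp_smul.mp hg
  refine ⟨H.τ ^ m • c.f^[T] (c.Y C), c.smul_mem _ _ (iterate_mem (Y_mem hC.sparse) T), ?_,
    fun g hg => ⟨?_, ?_⟩, ⟨R₃ + |m|, fun g hg => ?_⟩, j - T, by omega,
    Set.not_disjoint_iff.mpr ⟨v, hv, ?_⟩⟩
  · exact ((hC.isMortal_of_ht_le hN hR₃).iterate T).smul _
  · simpa [mul_assoc] using mul_zpow_mem (H := H) (hconf C hC.sparse hC.subset T (hsupp hg)) (-m)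
  · obtain ⟨a, ha, hga⟩ := spread hC.sparse hC.subset (Nat.le_add_right T J) (hsupp hg)
    rw [H.ht_mul_zpow, abs_le] at hga
    have hR₂ := le_abs_self R₂
    by_cases ham : |H.ht a| ≤ |R₂| + |m| + r + b'
    · have haR := abs_le.mp ((hR a ((hCA a ham).mp ha)).trans (le_abs_self R))
      rw [lt_abs] at hm ⊢
      omega
    · have hm := abs_le.mp (le_refl |m|)
      rw [not_le, lt_abs] at ham
      rw [lt_abs]
      omega
  · have := hR₃ T le_rfl _ (hsupp hg)
    rw [H.ht_mul_zpow] at this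
    have htriangle := abs_add_le (H.ht g + m) (-m)
    rw [add_neg_cancel_right, abs_neg] at htriangle
    linarith
  · rw [iterate_smul, mem_supp_smul, ← Function.iterate_add_apply, Nat.sub_add_cancel (by omega)]
    exact hsurvive C hC.sparse fun n hn => hCA n (by grind [hb' n hn])

theorem Admissible.isMortal_of_forall_abs_le (hN : c.Confines N) [K.Normal] [K.FiniteIndex]
    (hA : c.Admissible H K A) {R : ℤ} (hR : ∀ a ∈ A, |H.ht a| ≤ R) : c.IsMortal (c.Y A) := by
  by_contra hcon
  have ⟨F, hF, hconf⟩ := hN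
  obtain ⟨V, hV, hfar⟩ := exists_far_survivor hF hconf hA hR hcon
  let IsBounded (P : Set X) (R : ℤ) : Prop :=
    ∀ x ∈ P, ∀ g ∈ c.supp x, g ∈ F * (N : Set G) ∧ |H.ht g| ≤ R
  obtain ⟨r, -, hr⟩ := H.exists_bound hF c.finite_D
  have bounded_sum {P : Set X} {z : X} (hz : c.IsSum c.D P z) {R : ℤ} (hP : IsBounded P R) :
      ∀ g ∈ c.supp z, g ∈ c.D * F * (N : Set G) ∧ |H.ht g| ≤ R + r := fun g hg => by
    obtain ⟨x, hx, d, hd, a, ha, rfl⟩ := Set.mem_iUnion₂.mp (hz.supp_subset hg)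
    have haF := hP x hx a ha
    rw [mul_assoc]
    exact ⟨Set.mul_mem_mul hd haF.1, by grind [hr d hd a haF.1]⟩
  obtain ⟨x₀, ⟨-, P, hPS, hP, hsum, R₁, hR₁⟩, R₂, J, hclear⟩ :=
    exists_eventually_disjoint_supp_of_superposes H (c.finite_D.mul hF) hV
    (𝒞 := {x | c.IsMortal x ∧ ∃ P ⊆ c.S, c.Separated c.D P ∧ c.IsSum c.D P x ∧ ∃ R, IsBounded P R})
    ⟨c.o, ⟨0, rfl⟩, ∅, by simp, by simp [Separated], ⟨by simp, fun g _ => by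
      rw [c.smul_o, dist_self]; exact c.η_pos.le⟩, 0, by simp [IsBounded]⟩ (fun x hx => hx.1)
    fun x ⟨_, P, _, _, hx, R, hR⟩ => ⟨R + r, bounded_sum hx hR⟩
  obtain ⟨r', -, hr'⟩ := H.exists_disjoint_mul hF c.finite_D
  obtain ⟨w, hwS, ⟨n, hn⟩, hwfar, ⟨R₃, hR₃⟩, j, hj, halive⟩ := hfar (max R₂ (R₁ + r')) J
  have hdisj : ∀ x ∈ P, Disjoint (c.D * c.supp x) (c.D * c.supp w) := fun x hx =>
    hr' R₁ _ _ (hR₁ x hx) fun b hb => (le_max_right _ _).trans_lt (hwfar b hb).2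
  have hPw : P ∪ {w} ⊆ c.S := Set.union_subset hPS (Set.singleton_subset_iff.mpr hwS)
  have hsep : c.Separated c.D (P ∪ {w}) :=
    hP.union (Set.pairwiseDisjoint_singleton _ _) (by simpa using hdisj)
  obtain ⟨x', hx'⟩ := c.exists_isSum _ hPw hsep
  have hevol := hclear w x' (hsum.superposes (IsSum.singleton c.one_mem_D w) hx') fun g hg =>
    (le_max_left _ _).trans_lt (hwfar g hg).2
  refine halive ((hevol j hj).2 ⟨⟨n + J, ?_⟩, P ∪ {w}, hPw, hsep, hx', max R₁ R₃, ?_⟩)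
  · rw [(hevol _ (Nat.le_add_left J n)).1, iterate_eq_o_of_le hn (Nat.le_add_right n J)]
  · rintro x (hx | rfl) g hg
    · exact ⟨(hR₁ x hx g hg).1, (hR₁ x hx g hg).2.trans (le_max_left _ _)⟩
    · exact ⟨(hwfar g hg).1, (hR₃ g hg).trans (le_max_right _ _)⟩

/-- Only finitely many elements of `A` matter at a given place and time, and residual finiteness
provides periods under which their translates do not meet. -/
theorem exists_admissible_mem_supp [Group.ResiduallyFinite G] [hKn : K.Normal]
    [hKi : K.FiniteIndex] (hA : c.Sparse A) (hAN : A ⊆ N) {j : ℕ} {g : G}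
    (hg : g ∈ c.supp (c.f^[j] (c.Y A))) :
    ∃ L ≤ K, L.Normal ∧ L.FiniteIndex ∧ ∃ B, c.Admissible H L B ∧
      (∀ b ∈ B, ∃ a ∈ A, H.ht b = H.ht a) ∧ g ∈ c.supp (c.f^[j] (c.Y B)) := by
  obtain ⟨W, hW, hwin⟩ := exists_window_supp hA hg
  have hA' : c.Sparse (A ∩ W) := hA.mono Set.inter_subset_left
  have hfin : (A ∩ W).Finite := hW.inter_of_right A
  obtain ⟨W', hW', hwin'⟩ := exists_window_supp hA'
    (hwin _ hA' fun n hn => ⟨And.left, fun h => ⟨h, hn⟩⟩)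
  obtain ⟨L, hL, hLn, hLi, hLone⟩ := exists_normal_finiteIndex_of_residuallyFinite K
    ((((hfin.inv.mul c.finite_Q.inv).mul c.finite_Q).mul hfin).union (hfin.inv.mul hW'))
  have hsparse : c.Sparse ((A ∩ W) * (H.per L : Set G)) := by
    refine sparse_of_forall_eq ?_
    rintro _ ⟨a, ha, l, hl, rfl⟩ _ ⟨b, hb, k, hk, rfl⟩ g hga hgb
    have hlk : l = k := mul_inv_eq_one.mp <| hLone _ (Or.inl ⟨_, Set.mul_mem_mul (Set.mul_mem_mul
      (Set.inv_mem_inv.mpr ha) (Set.inv_mem_inv.mpr hga)) hgb, b, hb, by dsimp only; group⟩)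
      (L.mul_mem hl.2 (L.inv_mem hk.2))
    subst hlk
    rw [hA'.eq ha hb (g := g * l⁻¹) (by simpa [mul_assoc] using hga)
      (by simpa [mul_assoc] using hgb)]
  refine ⟨L, hL, hLn, hLi, _, ⟨hsparse, ?_, ?_⟩, ?_, hwin' _ hsparse fun n hn => ⟨?_, fun h =>
    ⟨n, h, 1, (H.per L).one_mem, mul_one n⟩⟩⟩
  · rintro _ ⟨a, ha, l, hl, rfl⟩
    exact N.mul_mem (hAN ha.1) hl.1.1
  · rintro _ ⟨a, ha, l, hl, rfl⟩ k hk
    exact ⟨a, ha, l * k, (H.per L).mul_mem hl hk, (mul_assoc a l k).symm⟩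
  · rintro _ ⟨a, ha, l, hl, rfl⟩
    exact ⟨a, ha.1, H.ht_mul_per a hl⟩
  · rintro ⟨a, ha, l, hl, rfl⟩
    have : l = 1 := hLone l (Or.inr ⟨a⁻¹, Set.inv_mem_inv.mpr ha, _, hn, by simp⟩) hl.2
    simpa [this] using ha

theorem Confines.ker [Group.ResiduallyFinite G] (hN : c.Confines N) (H : Height N) :
    c.Confines H.ker := by
  by_contra hcon
  have ⟨F, hF, hconf⟩ := hN
  obtain ⟨V, hV, hfar⟩ := exists_far_survivor_of_not_confines_ker hF hconf hcon
  obtain ⟨d, -, hd⟩ := c.exists_ht_gap H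
  obtain ⟨r, -, spread⟩ := c.exists_ht_spread H 0
  have bounded {A : Set G} (hA : c.Sparse A) (hAN : A ⊆ N) {R : ℤ} (hR : ∀ a ∈ A, |H.ht a| ≤ R) :
      ∀ g ∈ c.supp (c.Y A), g ∈ F * (N : Set G) ∧ |H.ht g| ≤ R + r := fun g hg => by
    obtain ⟨a, ha, hga⟩ := spread hA hAN le_rfl hg
    exact ⟨hconf A hA hAN 0 hg,
      by linarith [abs_sub_abs_le_abs_sub (H.ht g) (H.ht a), hR a ha]⟩
  obtain ⟨_, ⟨A₀, K, _, _, hA₀, R₀, hR₀, rfl⟩, R, J, hclear⟩ :=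
    exists_eventually_disjoint_supp_of_superposes H hF hV
    (𝒞 := {x | ∃ (A : Set G) (K : Subgroup G), K.Normal ∧ K.FiniteIndex ∧ c.Admissible H K A ∧
      ∃ R : ℤ, (∀ a ∈ A, |H.ht a| ≤ R) ∧ c.Y A = x})
    ⟨_, ∅, ⊤, inferInstance, inferInstance, .empty, 0, by simp, rfl⟩
    (fun _ ⟨_, _, _, _, hA, _, hR, hx⟩ => hx ▸ hA.isMortal_of_forall_abs_le hN hR)
    fun _ ⟨_, _, _, _, hA, R, hR, hx⟩ => ⟨R + r, hx ▸ bounded hA.sparse hA.subset hR⟩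
  obtain ⟨A, hA, hAN, ⟨m, hm, hAm⟩, j, hj, halive⟩ := hfar (max (R + r) (R₀ + d)) J
  obtain ⟨v, hv, hvA⟩ := Set.not_disjoint_iff.mp halive
  obtain ⟨L, hL, hLn, hLi, B, hB, hBA, hvB⟩ :=
    exists_admissible_mem_supp (H := H) (K := K) hA hAN hvA
  have hBm {b : G} (hb : b ∈ B) : H.ht b = m := by
    obtain ⟨a, ha, hba⟩ := hBA b hb
    rw [hba, hAm a ha]
  have hunion : c.Admissible H L (A₀ ∪ B) := (hA₀.mono_per hL).union hB hd fun a ha b hb => by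
    rw [hBm hb, abs_sub_comm]
    linarith [abs_sub_abs_le_abs_sub m (H.ht a), hR₀ a ha, le_max_right (R + r) (R₀ + d)]
  refine Set.disjoint_left.mp ((hclear _ _ (superposes_union hunion.sparse) (fun g hg => ?_) j
    hj).2 ⟨_, L, hLn, hLi, hunion, max R₀ |m|, ?_, rfl⟩) hv hvB
  · obtain ⟨b, hb, hgb⟩ := spread hB.sparse hB.subset le_rfl hg
    rw [hBm hb, abs_sub_comm] at hgb
    linarith [abs_sub_abs_le_abs_sub m (H.ht g), le_max_left (R + r) (R₀ + d)]
  · rintro a (ha | ha)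
    exacts [(hR₀ a ha).trans (le_max_left _ _), (congrArg _ (hBm ha)).trans_le (le_max_right _ _)]

end Descent

end SumSystem

/-! ### Descent along a series -/

theorem mem_map_subtype_iff {G : Type*} [Group G] {N : Subgroup G} {K : Subgroup N} {g : G} :
    g ∈ K.map N.subtype ↔ ∃ h : g ∈ N, ⟨g, h⟩ ∈ K := by
  simp

theorem Height.exists_ker_eq {G : Type u} [Group G] {N : Subgroup G} {φ : N →* Multiplicative ℤ}
    (hφ : φ ≠ 1) : ∃ H : Height N, H.ker = φ.ker.map N.subtype := by
  let ψ (n : N) : ℤ := (φ n).toAdd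
  obtain ⟨⟨_, τ, rfl⟩, hτ⟩ := IsCyclic.exists_generator (α := φ.range)
  have hdvd (n : N) : ψ τ ∣ ψ n := by
    obtain ⟨i, hi⟩ := hτ ⟨φ n, n, rfl⟩
    have hi : φ τ ^ i = φ n := congrArg Subtype.val hi
    exact ⟨i, by simp only [ψ, ← hi, toAdd_zpow, smul_eq_mul, mul_comm]⟩
  have hψτ : ψ τ ≠ 0 := fun h => hφ <| MonoidHom.ext fun n =>
    Multiplicative.toAdd.injective (zero_dvd_iff.mp (h ▸ hdvd n))
  let ρ (g : G) : N := ⟨(g : G ⧸ N).out⁻¹ * g, QuotientGroup.eq.mp (Quotient.out_eq' _)⟩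
  have hρ (g : G) (n : N) : ψ (ρ (g * n)) = ψ (ρ g) + ψ n := by
    have : ρ (g * n) = ρ g * n := Subtype.ext <| by
      simp only [ρ, QuotientGroup.mk_mul_of_mem g n.2, Subgroup.coe_mul, mul_assoc]
    simp only [ψ, this, map_mul, toAdd_mul]
  have hN (n : N) : ψ (ρ n) - ψ (ρ 1) = ψ n := by
    rw [sub_eq_iff_eq_add', ← hρ, one_mul]
  refine ⟨⟨fun g => (ψ (ρ g) - ψ (ρ 1)) / ψ τ, τ, τ.2, by rw [hN, Int.ediv_self hψτ],
    fun g n hn => ?_⟩, Subgroup.ext fun n => ?_⟩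
  · lift n to N using hn
    rw [hN, hρ, add_sub_right_comm, Int.add_ediv_of_dvd_right (hdvd n)]
  · rw [Height.mem_ker, mem_map_subtype_iff, ← exists_prop]
    refine exists_congr fun hn => ?_
    change (ψ (ρ (⟨n, hn⟩ : N)) - ψ (ρ 1)) / ψ τ = 0 ↔ _
    rw [hN ⟨n, hn⟩]
    exact ⟨fun h => toAdd_eq_zero.mp (Int.eq_zero_of_ediv_eq_zero (hdvd _) h),
      fun h => by rw [show ψ ⟨n, hn⟩ = 0 from toAdd_eq_zero.mpr h, Int.zero_ediv]⟩

namespace SumSystem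

variable {G : Type u} {X : Type v} [Group G] [Group.ResiduallyFinite G] [MetricSpace X]
  [MulAction G X] [CompactSpace X] [ContinuousConstSMul G X] {c : SumSystem G X} {N : Subgroup G}

theorem Confines.map_ker_int (hN : c.Confines N) (φ : N →* Multiplicative ℤ) :
    c.Confines (φ.ker.map N.subtype) := by
  by_cases hφ : φ = 1
  · rwa [hφ, MonoidHom.ker_one, ← MonoidHom.range_eq_map, N.range_subtype]
  · obtain ⟨H, hH⟩ := Height.exists_ker_eq hφ
    exact hH ▸ hN.ker H

theorem Confines.map_iInf_ker_int (hN : c.Confines N) {ι : Type*} (s : Finset ι)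
    (φ : ι → N →* Multiplicative ℤ) : c.Confines ((⨅ i ∈ s, (φ i).ker).map N.subtype) := by
  classical
  induction s using Finset.induction_on with
  | empty => simpa [← MonoidHom.range_eq_map] using hN
  | insert i s _ ih =>
    convert ih.map_ker_int ((φ i).comp (Subgroup.inclusion (Subgroup.map_subtype_le _))) using 1
    ext n
    simp only [Finset.mem_insert, iInf_or, iInf_inf_eq, iInf_iInf_eq_left, mem_map_subtype_iff,
      Subgroup.mem_inf, MonoidHom.mem_ker, MonoidHom.comp_apply]
    exact ⟨fun ⟨h, hi, hs⟩ => ⟨⟨h, hs⟩, hi⟩, fun ⟨⟨h, hs⟩, hi⟩ => ⟨h, hi, hs⟩⟩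

theorem Confines.map_ker (hN : c.Confines N) {B : Type*} [CommGroup B] [Group.FG B] (φ : N →* B) :
    c.Confines (φ.ker.map N.subtype) := by
  obtain ⟨ι, κ, _, _, p, hp, e, ⟨f⟩⟩ := CommGroup.equiv_free_prod_prod_multiplicative_zmod B
  have (i : ι) : NeZero (p i ^ e i) := ⟨pow_ne_zero _ (hp i).ne_zero⟩
  have (i : ι) : Finite (Multiplicative (ZMod (p i ^ e i))) := inferInstanceAs (Finite (ZMod _))
  let ψ := f.toMonoidHom.comp φ
  refine (hN.map_iInf_ker_int Finset.univ fun k =>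
    (Pi.evalMonoidHom _ k).comp ((MonoidHom.fst _ _).comp ψ)).of_finiteIndex ?_ ?_
  · refine Subgroup.map_mono (le_iInf₂ fun k _ n hn => ?_)
    simp only [MonoidHom.mem_ker, MonoidHom.comp_apply, ψ, MonoidHom.mem_ker.mp hn, map_one]
  · let χ := ((MonoidHom.snd _ _).comp ψ).comp (Subgroup.inclusion (Subgroup.map_subtype_le
      (⨅ k ∈ Finset.univ, ((Pi.evalMonoidHom _ k).comp ((MonoidHom.fst _ _).comp ψ)).ker)))
    refine Subgroup.finiteIndex_of_le (H := χ.ker) fun n hn => ?_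
    obtain ⟨n, hn'⟩ := n
    obtain ⟨h, hint⟩ := mem_map_subtype_iff.mp hn'
    simp only [Subgroup.mem_iInf] at hint
    refine mem_map_subtype_iff.mpr ⟨h, f.injective ?_⟩
    rw [map_one]
    exact Prod.ext (funext fun k => hint k (Finset.mem_univ k)) hn

theorem Confines.exists_le {S T : Subgroup G} [(T.subgroupOf S).Normal]
    (hLVA : IsLocallyVirtuallyAbelian (S ⧸ T.subgroupOf S)) (hN : c.Confines N) (hNS : N ≤ S) :
    ∃ M ≤ T, c.Confines M := by
  obtain ⟨M, hMN, hfg, hM⟩ := hN.exists_fg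
  have : Group.FG M := (Group.fg_iff_subgroup_fg M).mpr hfg
  let q : M →* S ⧸ T.subgroupOf S :=
    (QuotientGroup.mk' _).comp (Subgroup.inclusion (hMN.trans hNS))
  obtain ⟨A, hA, hcomm⟩ := hLVA q.range ((Group.fg_iff_subgroup_fg _).mp (Group.fg_range q))
  have : Group.FG q.range := Group.fg_range q
  have : Group.FG A := Subgroup.fg_of_index_ne_zero A
  let : CommGroup A := { mul_comm := hcomm.is_comm.comm }
  let L := (A.comap q.rangeRestrict).map M.subtype
  let φ : L →* A :=
    (q.rangeRestrict.comp (Subgroup.inclusion (Subgroup.map_subtype_le _))).codRestrict A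
      fun n => (mem_map_subtype_iff.mp n.2).2
  have hL : c.Confines L := by
    refine hM.of_finiteIndex (Subgroup.map_subtype_le _) ?_
    rw [Subgroup.subgroupOf, Subgroup.comap_map_eq_self_of_injective M.subtype_injective]
    exact ⟨by rw [A.index_comap_of_surjective q.rangeRestrict_surjective]; exact hA.index_ne_zero⟩
  refine ⟨_, fun g hg => ?_, hL.map_ker φ⟩
  obtain ⟨h, hg⟩ := mem_map_subtype_iff.mp hg
  have hqg : q ⟨g, Subgroup.map_subtype_le _ h⟩ = 1 :=
    congrArg (fun a : A => ((a : q.range) : S ⧸ T.subgroupOf S)) hg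
  exact (QuotientGroup.eq_one_iff (N := T.subgroupOf S) _).mp hqg

theorem isMortal_y_of_series (c : SumSystem G X) (hser : HasLocallyVirtuallyAbelianSeries G) :
    c.IsMortal c.y := by
  obtain ⟨n, S, h0, hn, hS⟩ := hser
  have key {i : ℕ} (hi : i ≤ n) : ∃ M ≤ S i, c.Confines M := by
    induction hi using Nat.decreasingInduction with
    | self => exact ⟨⊤, hn.ge, confines_top c⟩
    | of_succ i hi ih =>
      obtain ⟨N, hNS, hN⟩ := ih
      obtain ⟨_, _, hLVA⟩ := hS i hi
      exact hN.exists_le hLVA hNS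
  obtain ⟨M, hM, hc⟩ := key n.zero_le
  rw [h0, le_bot_iff] at hM
  exact (hM ▸ hc).isMortal_y

end SumSystem

/-! ### Extensions with finite kernel -/

theorem IsVirtuallyAbelian.of_mulEquiv {H K : Type*} [Group H] [Group K] (e : H ≃* K)
    (hK : IsVirtuallyAbelian K) : IsVirtuallyAbelian H := by
  obtain ⟨A, hA, hcomm⟩ := hK
  refine ⟨A.comap e.toMonoidHom,
    ⟨by rw [Subgroup.index_comap_of_surjective _ e.surjective]; exact hA.index_ne_zero⟩, ⟨⟨?_⟩⟩⟩
  rintro ⟨x, hx⟩ ⟨y, hy⟩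
  have hxy : e x * e y = e y * e x :=
    congrArg Subtype.val (hcomm.is_comm.comm ⟨e x, hx⟩ ⟨e y, hy⟩)
  exact Subtype.ext (e.injective (by simpa only [Subgroup.coe_mul, map_mul] using hxy))

theorem subgroup_fg_map {H K : Type*} [Group H] [Group K] (f : H →* K) {L : Subgroup H}
    (hL : L.FG) : (L.map f).FG := by
  have : Group.FG L := (Group.fg_iff_subgroup_fg L).mpr hL
  exact (Group.fg_iff_subgroup_fg _).mp
    (Group.fg_of_surjective (f := f.subgroupMap L) (f.subgroupMap_surjective L))

theorem IsLocallyVirtuallyAbelian.of_injective {H K : Type*} [Group H] [Group K] {f : H →* K}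
    (hf : Function.Injective f) (hK : IsLocallyVirtuallyAbelian K) :
    IsLocallyVirtuallyAbelian H :=
  fun L hL => (hK (L.map f) (subgroup_fg_map f hL)).of_mulEquiv (L.equivMapOfInjective f hf)

theorem IsLocallyVirtuallyAbelian.of_finite (H : Type*) [Group H] [Finite H] :
    IsLocallyVirtuallyAbelian H :=
  fun _ _ => ⟨⊥, inferInstance, inferInstance⟩

theorem HasLocallyVirtuallyAbelianSeries.of_finite_ker {H K : Type*} [Group H] [Group K]
    (φ : H →* K) (hφ : Finite φ.ker) (hK : HasLocallyVirtuallyAbelianSeries K) :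
    HasLocallyVirtuallyAbelianSeries H := by
  obtain ⟨n, S, h0, hn, hS⟩ := hK
  refine ⟨n + 1, fun i => i.casesOn ⊥ fun i => (S i).comap φ, rfl, by simp [hn], fun i hi => ?_⟩
  cases i with
  | zero =>
    have : Finite ((S 0).comap φ) := by rwa [h0]
    have hnorm : ((⊥ : Subgroup H).subgroupOf ((S 0).comap φ)).Normal := by
      rw [Subgroup.bot_subgroupOf]; infer_instance
    exact ⟨bot_le, hnorm, .of_finite ((S 0).comap φ ⧸ (⊥ : Subgroup H).subgroupOf _)⟩
  | succ i =>
    obtain ⟨hle, hnorm, hLVA⟩ := hS i (by omega)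
    have heq : ((S i).comap φ).subgroupOf ((S (i + 1)).comap φ) =
        ((S i).subgroupOf (S (i + 1))).comap (φ.subgroupComap (S (i + 1))) := rfl
    have hnorm' : (((S i).comap φ).subgroupOf ((S (i + 1)).comap φ)).Normal := by
      rw [heq]; infer_instance
    refine ⟨Subgroup.comap_mono hle, hnorm', hLVA.of_injective
      (f := QuotientGroup.map _ _ (φ.subgroupComap (S (i + 1))) heq.le) ?_⟩
    rw [← MonoidHom.ker_eq_bot_iff, QuotientGroup.ker_map, ← heq, QuotientGroup.map_mk'_self]

/-! ### The invariant core of a tier -/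

/-- The gluing property of designations, with a family of disjoint sets indexed by an arbitrary type
in place of a partition indexed by a type in the universe of the group. -/
theorem exists_realization_of_pairwise_disjoint {G : Type u} {X : Type v} [Group G] [MetricSpace X]
    [MulAction G X] {o : X} (ho : ∀ g : G, g • o = o) {Y : Set X} (hoY : o ∈ Y) {ε δ : ℝ}
    {E : Set G} (hδ : 0 < δ)
    (hglue : ∀ (I : Type u) (A : I → Set G) (x : I → X), (∀ i, x i ∈ Y) →
      IsDesignation o δ E A x → ∃ y, IsRealization ε A x y)
    {J : Type*} {A : J → Set G} {x : J → X} (hx : ∀ j, x j ∈ Y)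
    (hA : Pairwise fun i j => Disjoint (A i) (A j))
    (hborder : ∀ j, ∀ g ∈ border E (A j), dist (g • x j) o < δ) :
    ∃ y, (∀ j, ∀ g ∈ A j, dist (g • y) (g • x j) < ε) ∧
      ∀ g, (∀ j, g ∉ A j) → dist (g • y) o < ε := by
  let B : Option (Set.range A) → Set G := fun i => i.elim (⋃ j, A j)ᶜ Subtype.val
  let z : Option (Set.range A) → X := fun i => i.elim o fun a => x a.2.choose
  have hchoose (a : Set.range A) : A a.2.choose = a := a.2.choose_spec
  have hnone (a : Set.range A) : Disjoint (B none) (B (some a)) :=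
    disjoint_compl_left.mono_right <| a.2.choose_spec.symm.subset.trans (Set.subset_iUnion A _)
  have hzY : ∀ i, z i ∈ Y := by rintro (_ | a); exacts [hoY, hx _]
  have hdes : IsDesignation o δ E B z := by
    refine ⟨?_, ?_, ?_⟩
    · rintro (_ | a) (_ | b) hab
      · exact (hab rfl).elim
      · exact hnone b
      · exact (hnone a).symm
      · have hne : a.2.choose ≠ b.2.choose := fun h => hab <| congrArg some <| Subtype.ext <| by
          rw [← hchoose a, ← hchoose b, h]
        simpa only [B, Option.elim_some, hchoose] using hA hne
    · refine Set.eq_univ_of_forall fun g => Set.mem_iUnion.mpr ?_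
      by_cases hg : ∃ j, g ∈ A j
      · exact ⟨some ⟨_, hg.choose, rfl⟩, hg.choose_spec⟩
      · exact ⟨none, by simpa [B] using hg⟩
    · rintro (_ | a) g hg
      · simpa [z, ho] using hδ
      · exact hborder _ g (by rwa [hchoose])
  obtain ⟨y, hy⟩ := hglue _ B z hzY hdes
  refine ⟨y, fun j g hg => ?_, fun g hg => ?_⟩
  · let a : Set.range A := ⟨A j, j, rfl⟩
    have hj : a.2.choose = j := by
      by_contra hne
      exact Set.disjoint_left.mp (hA hne) ((hchoose a).symm ▸ hg : g ∈ A a.2.choose) hg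
    have := hy (some a) g hg
    rwa [show z (some a) = x j from congrArg x hj] at this
  · have := hy none g (by simpa [B] using hg)
    rwa [show z none = o from rfl, ho] at this

namespace TieredSystem

variable {𝒳 : TieredSystem.{u, v}} {f : 𝒳.Space → 𝒳.Space}

theorem smul_zeroAt {t : 𝒳.Tier} (g : 𝒳.Grp t) : g • 𝒳.zeroAt t = 𝒳.zeroAt t := 𝒳.smul_zero t g

theorem IsEvolution.iterate_hom_smul (hf : 𝒳.IsEvolution f) {t s : 𝒳.Tier} (h : t ≤ s)
    {x : 𝒳.set t} (hx : ∀ k, f^[k] x ∈ 𝒳.set s) (g : 𝒳.Grp s) (k : ℕ) :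
    f^[k] (𝒳.hom h g • x : 𝒳.set t) = (g • (⟨f^[k] x, hx k⟩ : 𝒳.set s) : 𝒳.set s) := by
  induction k with
  | zero => exact 𝒳.hom_smul h g x
  | succ k ih =>
    have hmem : f (f^[k] x) ∈ 𝒳.set s := by
      rw [← Function.iterate_succ_apply' f]; exact hx (k + 1)
    have hstep := hf.2 s s le_rfl ⟨f^[k] x, hx k⟩ hmem g
    rw [𝒳.hom_refl, MonoidHom.id_apply] at hstep
    rw [Function.iterate_succ_apply', ih, hstep]
    simp only [Function.iterate_succ_apply']

theorem IsEvolution.iterate_smul (hf : 𝒳.IsEvolution f) {s : 𝒳.Tier} {x : 𝒳.set s}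
    (hx : ∀ k, f^[k] x ∈ 𝒳.set s) (g : 𝒳.Grp s) (k : ℕ) :
    f^[k] (g • x : 𝒳.set s) = (g • (⟨f^[k] x, hx k⟩ : 𝒳.set s) : 𝒳.set s) := by
  have := hf.iterate_hom_smul le_rfl hx g k
  rwa [𝒳.hom_refl, MonoidHom.id_apply] at this

/-- The points of the tier `u` whose whole orbit under `f` stays in the tier: the largest part of
the tier on which `f` acts. -/
def core (hf : 𝒳.IsEvolution f) (u : 𝒳.Tier) : SubMulAction (𝒳.Grp u) (𝒳.set u) where
  carrier := {x | ∀ k, f^[k] x ∈ 𝒳.set u}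
  smul_mem' g x hx k := by
    rw [hf.iterate_smul hx]
    exact Subtype.coe_prop _

variable (hf : 𝒳.IsEvolution f) (u : 𝒳.Tier)

instance : CompactSpace (core hf u) := by
  have : CompactSpace (𝒳.set u) := isCompact_iff_compactSpace.mp (𝒳.isCompact_set u)
  have hclosed : IsClosed {x : 𝒳.set u | ∀ k, f^[k] (x : 𝒳.Space) ∈ 𝒳.set u} := by
    rw [Set.ofPred_forall]
    exact isClosed_iInter fun k => (𝒳.isCompact_set u).isClosed.preimage
      ((hf.1.iterate k).comp continuous_subtype_val)
  exact isCompact_iff_compactSpace.mp hclosed.isCompact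

instance : ContinuousConstSMul (𝒳.Grp u) (core hf u) :=
  ⟨fun g => (continuous_subtype_val.const_smul g).subtype_mk _⟩

variable {hf u}

/-- The restriction of the evolution map to the core of a tier. -/
def coreMap (x : core hf u) : core hf u :=
  ⟨⟨f x, x.2 1⟩, fun k => by simpa only [← Function.iterate_succ_apply] using x.2 (k + 1)⟩

theorem coe_iterate_coreMap (x : core hf u) (k : ℕ) : (coreMap^[k] x : 𝒳.Space) = f^[k] x := by
  induction k with
  | zero => rfl
  | succ k ih => simp only [Function.iterate_succ_apply', ← ih, coreMap]

theorem core_ext {x y : core hf u} (h : (x : 𝒳.Space) = y) : x = y :=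
  Subtype.ext (Subtype.ext h)

/-- The special point, as a point of the core. -/
def coreZero (hf : 𝒳.IsEvolution f) (hnil : IsAsymptoticallyNilpotent 𝒳.zero f) (u : 𝒳.Tier) :
    core hf u :=
  ⟨𝒳.zeroAt u, fun k => (Function.iterate_fixed (hnil.map_zero hf.1) k).symm ▸ 𝒳.zero_mem u⟩

theorem exists_localEndo_core (hf : 𝒳.IsEvolution f)
    (hnil : IsAsymptoticallyNilpotent 𝒳.zero f) (u : 𝒳.Tier) :
    ∃ c : LocalEndo (𝒳.Grp u) (core hf u), c.o = coreZero hf hnil u ∧ c.f = coreMap := by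
  obtain ⟨Δ, hΔ, -, hexp⟩ := 𝒳.expansive u
  obtain ⟨c, ho, hc, -⟩ := LocalEndo.exists_of_expansive (G := 𝒳.Grp u) (X := core hf u)
    (o := coreZero hf hnil u) (f := coreMap) (η := Δ / 4) (by positivity)
    (fun g => core_ext (congrArg Subtype.val (𝒳.smul_zero u g)))
    (fun x y h => Subtype.ext (hexp _ _ fun g => (h g).trans_eq (mul_div_cancel₀ Δ four_ne_zero)))
    (((hf.1.comp (continuous_subtype_val.comp continuous_subtype_val)).subtype_mk _).subtype_mk _)
    (fun g x => core_ext (hf.iterate_smul x.2 g 1)) (fun x => by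
      rw [tendsto_subtype_rng, tendsto_subtype_rng]
      simp only [coe_iterate_coreMap]
      exact hnil x)
  exact ⟨c, ho, hc⟩

theorem finite_hom_preimage {t t' : 𝒳.Tier} (h : t ≤ t') {s : Set (𝒳.Grp t)} (hs : s.Finite) :
    (𝒳.hom h ⁻¹' s).Finite :=
  hs.preimage' fun g _ => 𝒳.hom_finite_fibre h g

section LowerTier

variable {w : 𝒳.Tier} {x : core hf u}

theorem coe_smul_core (h : w ≤ u) (hx : (x : 𝒳.Space) ∈ 𝒳.set w) (g : 𝒳.Grp u) :
    ((g • x : core hf u) : 𝒳.Space) = (𝒳.hom h g • (⟨x, hx⟩ : 𝒳.set w) : 𝒳.set w) :=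
  (𝒳.hom_smul h g ⟨x, hx⟩).symm

theorem coe_smul_core_mem (h : w ≤ u) (hx : (x : 𝒳.Space) ∈ 𝒳.set w) (g : 𝒳.Grp u) :
    ((g • x : core hf u) : 𝒳.Space) ∈ 𝒳.set w := by
  rw [coe_smul_core h hx]
  exact Subtype.coe_prop _

theorem dist_smul_core (h : w ≤ u) (hx : (x : 𝒳.Space) ∈ 𝒳.set w) {y : core hf u}
    (hy : (y : 𝒳.Space) ∈ 𝒳.set w) (g : 𝒳.Grp u) :
    dist (g • x) (g • y) =
      dist (𝒳.hom h g • (⟨x, hx⟩ : 𝒳.set w)) (𝒳.hom h g • (⟨y, hy⟩ : 𝒳.set w)) := by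
  rw [Subtype.dist_eq, Subtype.dist_eq, Subtype.dist_eq, coe_smul_core h hx, coe_smul_core h hy]

theorem dist_smul_coreZero {hnil : IsAsymptoticallyNilpotent 𝒳.zero f}
    (h : w ≤ u) (hx : (x : 𝒳.Space) ∈ 𝒳.set w) (g : 𝒳.Grp u) :
    dist (g • x) (coreZero hf hnil u) =
      dist (𝒳.hom h g • (⟨x, hx⟩ : 𝒳.set w)) (𝒳.zeroAt w) := by
  rw [Subtype.dist_eq, Subtype.dist_eq, Subtype.dist_eq, coe_smul_core h hx]
  rfl

theorem hom_mem_image_mul_supp (h : w ≤ u) (hx : (x : 𝒳.Space) ∈ 𝒳.set w)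
    {c : LocalEndo (𝒳.Grp u) (core hf u)} {D : Set (𝒳.Grp u)} {g : 𝒳.Grp u} :
    𝒳.hom h g ∈ 𝒳.hom h '' (D * c.supp x) ↔ g ∈ D * c.supp x := by
  refine ⟨?_, Set.mem_image_of_mem _⟩
  rintro ⟨_, ⟨d, hd, s, hs, rfl⟩, hds⟩
  refine ⟨d, hd, d⁻¹ * g, ?_, mul_inv_cancel_left _ _⟩
  have hhom : 𝒳.hom h (d⁻¹ * g) = 𝒳.hom h s := by
    rw [map_mul, ← hds, ← map_mul, inv_mul_cancel_left]
  have hsmul : (d⁻¹ * g) • x = s • x := core_ext (by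
    rw [coe_smul_core h hx, coe_smul_core h hx, hhom])
  rwa [LocalEndo.supp, Set.mem_ofPred_eq, hsmul]

end LowerTier

/-- Points of the tier `t` can be glued to points of the tier `w`: the condition of weak
`0`-gluing for fixed `t` and `w`. -/
def Glues (𝒳 : TieredSystem.{u, v}) (t w : 𝒳.Tier) : Prop :=
  ∀ ε > (0 : ℝ), ∃ δ > (0 : ℝ), ∃ E : Set (𝒳.Grp w), E.Finite ∧
    ∀ (I : Type u) (A : I → Set (𝒳.Grp w)) (x : I → 𝒳.set w),
      (∀ i, (x i : 𝒳.Space) ∈ 𝒳.set t) → IsDesignation (𝒳.zeroAt w) δ E A x →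
        ∃ y : 𝒳.set w, IsRealization ε A x y

theorem exists_isSum_core {hnil : IsAsymptoticallyNilpotent 𝒳.zero f} {t w : 𝒳.Tier} (htw : t ≤ w)
    (hglue : 𝒳.Glues t w) (hwu : w ≤ u) (hstab : ∀ k, f^[k] '' 𝒳.set w ⊆ 𝒳.set u)
    (c : LocalEndo (𝒳.Grp u) (core hf u)) (hco : c.o = coreZero hf hnil u) :
    ∃ D₀ : Set (𝒳.Grp u), D₀.Finite ∧ ∀ D ⊇ D₀, ∀ P : Set (core hf u),
      (∀ x ∈ P, (x : 𝒳.Space) ∈ 𝒳.set t) → c.Separated D P →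
        ∃ z : core hf u, (z : 𝒳.Space) ∈ 𝒳.set w ∧ c.IsSum D P z := by
  obtain ⟨δ, hδ, E, hE, hglue⟩ := hglue c.η c.η_pos
  obtain ⟨F, hF, hwin⟩ := exists_finite_expansivity_window c.eq_of_close hδ
  refine ⟨(𝒳.hom hwu ⁻¹' E) * F⁻¹, (finite_hom_preimage hwu hE).mul hF.inv,
    fun D hD P hP hsep => ?_⟩
  have hPw : ∀ x ∈ P, (x : 𝒳.Space) ∈ 𝒳.set w := fun x hx => 𝒳.set_mono htw (hP x hx)
  have hdisj : Pairwise fun x y : P =>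
      Disjoint (𝒳.hom hwu '' (D * c.supp (x : core hf u))) (𝒳.hom hwu '' (D * c.supp y)) := by
    intro x y hxy
    refine Set.disjoint_left.mpr ?_
    rintro _ ⟨g, hgx, rfl⟩ hgy
    exact hxy (Subtype.ext (hsep.eq x.2 y.2 hgx
      ((hom_mem_image_mul_supp hwu (hPw y y.2)).mp hgy)))
  have hborder : ∀ x : P, ∀ g ∈ border E (𝒳.hom hwu '' (D * c.supp (x : core hf u))),
      dist (g • (⟨x, hPw x x.2⟩ : 𝒳.set w)) (𝒳.zeroAt w) < δ := by
    rintro x g ⟨-, e, he, heg⟩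
    obtain ⟨g, rfl⟩ := 𝒳.hom_surjective hwu g
    obtain ⟨e, rfl⟩ := 𝒳.hom_surjective hwu e
    rw [← map_mul, hom_mem_image_mul_supp hwu (hPw x x.2)] at heg
    rw [← dist_smul_coreZero hwu (hPw x x.2) (hnil := hnil), ← hco]
    refine hwin _ _ fun h hh => ?_
    have hsupp : h * g ∉ c.supp (x : core hf u) := fun hs =>
      heg ⟨e * h⁻¹, hD (Set.mul_mem_mul he (Set.inv_mem_inv.mpr hh)), _, hs, by group⟩
    rw [c.smul_o, ← mul_smul]
    linarith [LocalEndo.notMem_supp.mp hsupp, c.η_pos]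
  obtain ⟨y, hnear, hfar⟩ := exists_realization_of_pairwise_disjoint smul_zeroAt
    (Y := {x : 𝒳.set w | (x : 𝒳.Space) ∈ 𝒳.set t}) (𝒳.zero_mem t) hδ hglue
    (fun x : P => hP x x.2) hdisj hborder
  let z : core hf u := ⟨⟨y, 𝒳.set_mono hwu y.2⟩, fun k => hstab k ⟨y, y.2, rfl⟩⟩
  refine ⟨z, y.2, fun x hx g hg => ?_, fun g hg => ?_⟩
  · rw [dist_smul_core hwu y.2 (hPw x hx)]
    exact (hnear ⟨x, hx⟩ _ ⟨g, hg, rfl⟩).le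
  · rw [hco, dist_smul_coreZero hwu y.2]
    exact (hfar _ fun x hgx =>
      hg x x.2 ((hom_mem_image_mul_supp hwu (hPw x x.2)).mp hgx)).le

theorem finite_supp_of_isHomoclinic {hnil : IsAsymptoticallyNilpotent 𝒳.zero f} {t : 𝒳.Tier}
    (htu : t ≤ u) (c : LocalEndo (𝒳.Grp u) (core hf u)) (hco : c.o = coreZero hf hnil u)
    {y : core hf u} (hyt : (y : 𝒳.Space) ∈ 𝒳.set t)
    (hy : IsHomoclinic (𝒳.Grp t) (𝒳.zeroAt t) ⟨y, hyt⟩) : (c.supp y).Finite := by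
  obtain ⟨E, hE, hclose⟩ := hy c.η c.η_pos
  refine (finite_hom_preimage htu hE).subset fun g hg => by_contra fun hgE => ?_
  refine LocalEndo.notMem_supp.mpr ?_ hg
  rw [hco, dist_smul_coreZero htu hyt]
  exact (hclose _ hgE).le

theorem exists_sumSystem_of_isHomoclinic (hf : 𝒳.IsEvolution f) (hstab : 𝒳.IsStabilizing f)
    (hglue : 𝒳.IsWeaklyZeroGluing) (hnil : IsAsymptoticallyNilpotent 𝒳.zero f) {t : 𝒳.Tier}
    {y : 𝒳.set t} (hy : IsHomoclinic (𝒳.Grp t) (𝒳.zeroAt t) y) :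
    ∃ u, ∃ C : SumSystem (𝒳.Grp u) (core hf u),
      C.o = coreZero hf hnil u ∧ C.f = coreMap ∧ (C.y : 𝒳.Space) = y := by
  obtain ⟨w, htw, hw⟩ := hglue t
  obtain ⟨s, hws, hs⟩ := hstab w
  obtain ⟨w', hsw', hw'⟩ := hglue s
  obtain ⟨u, hw'u, hu⟩ := hstab w'
  have hsu : s ≤ u := hsw'.trans hw'u
  have htu : t ≤ u := htw.trans (hws.trans hsu)
  have hwsu : ∀ k, f^[k] '' 𝒳.set w ⊆ 𝒳.set u := fun k => (hs k).trans (𝒳.set_mono hsu)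
  obtain ⟨c, hco, hcf⟩ := exists_localEndo_core hf hnil u
  obtain ⟨D₁, hD₁, hsum₁⟩ := exists_isSum_core htw hw (hws.trans hsu) hwsu c hco
  obtain ⟨D₂, hD₂, hsum₂⟩ := exists_isSum_core hsw' hw' hw'u hu c hco
  let y₀ : core hf u :=
    ⟨⟨y, 𝒳.set_mono htu y.2⟩, fun k => hwsu k ⟨y, 𝒳.set_mono htw y.2, rfl⟩⟩
  exact ⟨u,
    { c with
      y := y₀
      D := insert 1 (D₁ ∪ D₂)
      S := {x | ∀ k, (c.f^[k] x : 𝒳.Space) ∈ 𝒳.set s}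
      finite_D := (hD₁.union hD₂).insert 1
      one_mem_D := Set.mem_insert _ _
      finite_supp_y := finite_supp_of_isHomoclinic htu c hco (y := y₀) y.2 hy
      smul_mem := fun g x hx k => by
        rw [LocalEndo.iterate_smul]
        exact coe_smul_core_mem hsu (hx k) g
      map_mem := fun x hx k => by
        rw [← Function.iterate_succ_apply c.f]
        exact hx (k + 1)
      exists_isSum_mem := fun P hP hsep => by
        obtain ⟨z, hzw, hz⟩ := hsum₁ _ (Set.subset_union_left.trans (Set.subset_insert _ _)) P
          (fun x hx => by
            obtain ⟨g, rfl⟩ := hP hx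
            exact coe_smul_core_mem htu (x := y₀) y.2 g) hsep
        refine ⟨z, fun k => ?_, hz⟩
        rw [hcf, coe_iterate_coreMap]
        exact hs k ⟨z, hzw, rfl⟩
      exists_isSum := fun P hP hsep => by
        obtain ⟨z, -, hz⟩ := hsum₂ _ (Set.subset_union_right.trans (Set.subset_insert _ _)) P
          (fun x hx => hP hx 0) hsep
        exact ⟨z, hz⟩ }, hco, hcf, rfl⟩

theorem exists_iterate_eq_zero_of_isHomoclinic (h3 : classThree 𝒳 f)
    (hser : HasLocallyVirtuallyAbelianSeries (𝒳.Grp ⊥))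
    (hnil : IsAsymptoticallyNilpotent 𝒳.zero f) {t : 𝒳.Tier} {y : 𝒳.set t}
    (hy : IsHomoclinic (𝒳.Grp t) (𝒳.zeroAt t) y) : ∃ n, f^[n] y = 𝒳.zero := by
  obtain ⟨⟨hf, hstab, hglue, -⟩, hRF⟩ := h3
  obtain ⟨u, C, hCo, hCf, hCy⟩ := exists_sumSystem_of_isHomoclinic hf hstab hglue hnil hy
  have := hRF u
  obtain ⟨n, hn⟩ := C.isMortal_y_of_series (hser.of_finite_ker (𝒳.hom (bot_le : ⊥ ≤ u))
    (𝒳.hom_finite_fibre bot_le 1))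
  refine ⟨n, ?_⟩
  rw [← hCy, ← coe_iterate_coreMap C.y, ← hCf, hn, hCo]
  rfl

theorem exists_iterate_eq_near_homoclinic (h2 : classTwo 𝒳 f)
    (hnil : IsAsymptoticallyNilpotent 𝒳.zero f) {t : 𝒳.Tier} {y : 𝒳.set t}
    (hy : IsHomoclinic (𝒳.Grp t) (𝒳.zeroAt t) y) {T : ℕ} (hT : f^[T] y = 𝒳.zero) (s : 𝒳.Tier)
    {ρ : ℝ} (hρ : 0 < ρ) :
    ∃ r > (0 : ℝ), ∃ w, ∀ x ∈ 𝒳.set s, dist x 𝒳.zero < r →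
      ∃ z ∈ 𝒳.set w, dist z y < ρ ∧ ∀ M ≥ T, f^[M] z = f^[M] x := by
  obtain ⟨hf, hstab, hglue, -⟩ := h2
  obtain ⟨a, hta, hsa⟩ := exists_ge_ge t s
  obtain ⟨w, haw, hw⟩ := hglue a
  obtain ⟨u, hwu, hu⟩ := hstab w
  have hcore : ∀ x ∈ 𝒳.set a, ∀ k, f^[k] x ∈ 𝒳.set u :=
    fun x hx k => hu k ⟨x, 𝒳.set_mono haw hx, rfl⟩
  obtain ⟨c, hco, hcf⟩ := exists_localEndo_core hf hnil u
  obtain ⟨D₀, hD₀, hsum⟩ := exists_isSum_core haw hw hwu hu c hco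
  let y₀ : core hf u := ⟨⟨y, hcore y (𝒳.set_mono hta y.2) 0⟩, hcore y (𝒳.set_mono hta y.2)⟩
  have hsupp : (c.supp y₀).Finite :=
    finite_supp_of_isHomoclinic (hta.trans (haw.trans hwu)) c hco (y := y₀) y.2 hy
  have hTy : c.f^[T] y₀ = c.o := by
    rw [hcf, hco]
    exact core_ext ((coe_iterate_coreMap y₀ T).trans hT)
  obtain ⟨r, hr, hball⟩ :=
    c.exists_ball_isSum_pair (hD₀.insert 1) (Set.mem_insert 1 D₀) hsupp hTy hρ
  refine ⟨r, hr, w, fun x hx hxr => ?_⟩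
  let x₀ : core hf u := ⟨⟨x, hcore x (𝒳.set_mono hsa hx) 0⟩, hcore x (𝒳.set_mono hsa hx)⟩
  obtain ⟨hsep, hpair⟩ := hball x₀ (by rwa [hco])
  obtain ⟨z, hzw, hz⟩ := hsum _ (Set.subset_insert _ _) _
    (by rintro _ (rfl | rfl); exacts [𝒳.set_mono hta y.2, 𝒳.set_mono hsa hx]) hsep
  obtain ⟨hzy, hzx⟩ := hpair z hz
  refine ⟨z, hzw, hzy, fun M hM => ?_⟩
  have hM : coreMap^[M] z = coreMap^[M] x₀ := hcf ▸ hzx M hM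
  rw [← coe_iterate_coreMap z, hM, coe_iterate_coreMap]

/-- A point near `0` has the same late iterates as its superposition with a homoclinic point around
which the attraction to `0` is uniform; the superposition is attracted uniformly. -/
theorem exists_stable_ball (h2 : classTwo 𝒳 f) (hnil : IsAsymptoticallyNilpotent 𝒳.zero f)
    (hmort : ∀ (t : 𝒳.Tier) (y : 𝒳.set t), IsHomoclinic (𝒳.Grp t) (𝒳.zeroAt t) y →
      ∃ n, f^[n] y = 𝒳.zero) (s : 𝒳.Tier) {ε : ℝ} (hε : 0 < ε) :
    ∃ ρ > (0 : ℝ), ∃ J : ℕ, ∀ x ∈ 𝒳.set s, dist x 𝒳.zero < ρ → ∀ M ≥ J,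
      dist (f^[M] x) 𝒳.zero < ε := by
  have hhom₀ : IsHomoclinic (𝒳.Grp ⊥) (𝒳.zeroAt ⊥) (𝒳.zeroAt ⊥) := fun ε hε =>
    ⟨∅, Set.finite_empty, fun g _ => by rwa [smul_zeroAt, dist_self]⟩
  obtain ⟨_, ⟨t, y, rfl, hy⟩, ρ, hρ, J, hattr⟩ := hnil.exists_uniformly_attracted h2.1.1
    (C := {x | ∃ (t : 𝒳.Tier) (y : 𝒳.set t), x = y ∧ IsHomoclinic (𝒳.Grp t) (𝒳.zeroAt t) y})
    ⟨𝒳.zero, ⊥, 𝒳.zeroAt ⊥, rfl, hhom₀⟩ (half_pos hε)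
  obtain ⟨T, hT⟩ := hmort t y hy
  obtain ⟨r, hr, w, hnear⟩ := exists_iterate_eq_near_homoclinic h2 hnil hy hT s (half_pos hρ)
  refine ⟨r, hr, max T J, fun x hx hxr M hM => ?_⟩
  obtain ⟨z, hzw, hzy, hzM⟩ := hnear x hx hxr
  rw [← hzM M (le_of_max_le_left hM)]
  obtain ⟨δ, hδ, hcont⟩ :=
    Metric.continuousAt_iff.mp ((h2.1.1.iterate M).continuousAt (x := z)) (ε / 2) (half_pos hε)
  obtain ⟨t', -, y', hzy', hhom⟩ := h2.2.2.2 w z hzw (min δ (ρ / 2)) (lt_min hδ (half_pos hρ))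
  have hy'y : dist (y' : 𝒳.Space) y < ρ := by
    linarith [dist_triangle_left (y' : 𝒳.Space) y z, min_le_right δ (ρ / 2)]
  have hattr' := hattr y' ⟨t', y', rfl, hhom⟩ hy'y M (le_of_max_le_right hM)
  have hclose : dist (f^[M] y') (f^[M] z) < ε / 2 :=
    hcont ((dist_comm _ _).trans_lt (hzy'.trans_le (min_le_left _ _)))
  linarith [dist_triangle_left (f^[M] z) 𝒳.zero (f^[M] y')]

theorem exists_uniform_entrance_time (hf : Continuous f)
    (hnil : IsAsymptoticallyNilpotent 𝒳.zero f) (t : 𝒳.Tier) {ρ : ℝ} (hρ : 0 < ρ) :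
    ∃ n, ∀ x ∈ 𝒳.set t, ∃ k ≤ n, dist (f^[k] x) 𝒳.zero < ρ := by
  obtain ⟨K, hK⟩ := (𝒳.isCompact_set t).elim_finite_subcover
    (fun k => {x | dist (f^[k] x) 𝒳.zero < ρ})
    (fun k => isOpen_lt ((hf.iterate k).dist continuous_const) continuous_const)
    (fun x _ => Set.mem_iUnion.mpr (((Metric.tendsto_nhds.mp (hnil x)) ρ hρ).exists))
  refine ⟨K.sup id, fun x hx => ?_⟩
  obtain ⟨k, hk, hkx⟩ := Set.mem_iUnion₂.mp (hK hx)
  exact ⟨k, Finset.le_sup (f := id) hk, hkx⟩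

theorem isNilpotentMapOn_of_mortal (h2 : classTwo 𝒳 f)
    (hnil : IsAsymptoticallyNilpotent 𝒳.zero f)
    (hmort : ∀ (t : 𝒳.Tier) (y : 𝒳.set t), IsHomoclinic (𝒳.Grp t) (𝒳.zeroAt t) y →
      ∃ n, f^[n] y = 𝒳.zero) (t : 𝒳.Tier) : IsNilpotentMapOn 𝒳.zero f (𝒳.set t) := by
  obtain ⟨s, hts, hs⟩ := h2.2.1 t
  have hstab : ∀ x ∈ 𝒳.set t, ∀ k, f^[k] x ∈ 𝒳.set s := fun x hx k => hs k ⟨x, hx, rfl⟩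
  obtain ⟨Δ, hΔ, -, hexp⟩ := 𝒳.expansive s
  obtain ⟨ρ, hρ, J, hball⟩ := exists_stable_ball h2 hnil hmort s hΔ
  obtain ⟨n, henter⟩ := exists_uniform_entrance_time h2.1.1 hnil t hρ
  have hclose : ∀ x ∈ 𝒳.set t, dist (f^[n + J] x) 𝒳.zero < Δ := by
    intro x hx
    obtain ⟨k, hk, hkx⟩ := henter x hx
    have := hball _ (hstab x hx k) hkx (n + J - k) (by omega)
    rwa [← Function.iterate_add_apply, Nat.sub_add_cancel (by omega)] at this
  refine ⟨n + J, fun x hx => congrArg Subtype.val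
    (hexp ⟨f^[n + J] x, hstab x hx _⟩ (𝒳.zeroAt s) fun g => ?_)⟩
  have hg := hclose _ (Subtype.coe_prop (𝒳.hom hts g • (⟨x, hx⟩ : 𝒳.set t)))
  rw [h2.1.iterate_hom_smul hts (x := ⟨x, hx⟩) (hstab x hx) g (n + J)] at hg
  rw [smul_zeroAt]
  exact hg.le

end TieredSystem

theorem IsNilRigidOn.classThree_of_series {G : Type u} [Group G]
    (hser : HasLocallyVirtuallyAbelianSeries G) : IsNilRigidOn classThree.{u, v} G := by
  rintro 𝒳 ⟨e⟩ f - h3 hnil t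
  have hser' : HasLocallyVirtuallyAbelianSeries (𝒳.Grp ⊥) :=
    hser.of_finite_ker e.toMonoidHom (by
      rw [(MonoidHom.ker_eq_bot_iff _).mpr e.injective]; infer_instance)
  exact TieredSystem.isNilpotentMapOn_of_mortal h3.1 hnil
    (fun _ _ hy => TieredSystem.exists_iterate_eq_zero_of_isHomoclinic h3 hser' hnil hy) t

/-! ### Systems with a single tier -/

/-- Asymptotically nilpotent endomorphisms of expansive `0`-gluing pointed `G`-systems with dense
homoclinic points are nilpotent: this is nil-rigidity on the pointed systems themselves, without
tiers. -/
def IsNilRigidOnSystems (G : Type u) [Group G] : Prop :=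
  ∀ (X : Type v) [MetricSpace X] [CompactSpace X] [MulAction G X] [ContinuousConstSMul G X]
    (o : X), (∀ g : G, g • o = o) → IsExpansive G X → IsZeroGluing G o →
    Dense {x : X | IsHomoclinic G o x} → ∀ f : X → X, IsEndomorphism G o f →
    IsAsymptoticallyNilpotent o f → ∃ n, ∀ x, f^[n] x = o

/-- Every `(δ, E)`-designation has an `ε`-realization. -/
def GluesAtScale {G : Type u} {X : Type v} [Group G] [MetricSpace X] [MulAction G X] (o : X)
    (ε δ : ℝ) (E : Set G) : Prop :=
  ∀ (I : Type u) (A : I → Set G) (x : I → X), IsDesignation o δ E A x →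
    ∃ y : X, IsRealization ε A x y

theorem IsDesignation.dist_smul_lt {G I : Type u} {X : Type v} [Group G] [MetricSpace X]
    [MulAction G X] {o : X} {δ : ℝ} {E F : Set G} {A : I → Set G} {x : I → X}
    (hA : IsDesignation o δ E A x) (hFE : F * F⁻¹ ⊆ E) (h1 : 1 ∈ F) {i : I} {g : G}
    (hg : g ∈ A i) (hFg : ∃ h ∈ F, h * g ∉ A i) {h : G} (hh : h ∈ F) {j : I} (hj : h * g ∈ A j) :
    dist ((h * g) • x j) o < δ := by
  obtain ⟨hdisj, -, hborder⟩ := hA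
  obtain ⟨k, hk, hkg⟩ : ∃ k ∈ F, k * g ∉ A j := by
    rcases eq_or_ne i j with rfl | hij
    · exact hFg
    · exact ⟨1, h1, by simpa using Set.disjoint_left.mp (hdisj hij) hg⟩
  refine hborder j _ ⟨hj, k * h⁻¹, hFE (Set.mul_mem_mul hk (Set.inv_mem_inv.mpr hh)), ?_⟩
  rwa [mul_assoc, inv_mul_cancel_left]

section Expansive

variable {G : Type u} {X : Type v} [Group G] [MetricSpace X] [CompactSpace X] [MulAction G X]
  [ContinuousConstSMul G X] {o : X} {η : ℝ}

theorem isHomoclinic_of_expansive (ho : ∀ g : G, g • o = o)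
    (hexp : ∀ x y : X, (∀ g : G, dist (g • x) (g • y) ≤ η) → x = y) {x : X}
    (hx : {g : G | η < dist (g • x) o}.Finite) : IsHomoclinic G o x := by
  intro ε hε
  obtain ⟨F, hF, hwin⟩ := exists_finite_expansivity_window hexp hε
  refine ⟨F⁻¹ * _, hF.inv.mul hx, fun g hg => ?_⟩
  rw [← ho g]
  refine hwin _ _ fun h hh => le_of_not_gt fun hfar => hg ?_
  rw [ho g, ho h, ← mul_smul] at hfar
  exact ⟨h⁻¹, Set.inv_mem_inv.mpr hh, h * g, hfar, inv_mul_cancel_left h g⟩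

theorem GluesAtScale.isZeroGluing (ho : ∀ g : G, g • o = o) (hη : 0 < η)
    (hexp : ∀ x y : X, (∀ g : G, dist (g • x) (g • y) ≤ 4 * η) → x = y) {δ : ℝ} (hδ : 0 < δ)
    {E : Set G} (hE : E.Finite) (hglue : GluesAtScale o η δ E) : IsZeroGluing G o := by
  intro ε hε
  obtain ⟨F₀, hF₀, hwin⟩ := exists_finite_expansivity_window hexp (half_pos hε)
  let F := insert 1 F₀
  have hF : F.Finite := hF₀.insert 1
  obtain ⟨δ', hδ', hδδ', hηδ', hεδ'⟩ : ∃ δ' > 0, δ' ≤ δ ∧ δ' ≤ η ∧ δ' ≤ ε / 2 :=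
    ⟨min δ (min η (ε / 2)), by positivity, by grind⟩
  refine ⟨δ', hδ', E ∪ F * F⁻¹, hE.union (hF.mul hF.inv), fun I A x hdes => ?_⟩
  have ⟨hdisj, hcov, hborder⟩ := hdes
  obtain ⟨y, hy⟩ := hglue I A x ⟨hdisj, hcov, fun i g ⟨hg, e, he, heg⟩ =>
    (hborder i g ⟨hg, e, Or.inl he, heg⟩).trans_le hδδ'⟩
  refine ⟨y, fun i g hg => ?_⟩
  by_cases hFg : ∀ h ∈ F, h * g ∈ A i
  · refine (hwin _ _ fun h hh => ?_).trans (half_lt_self hε)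
    rw [← mul_smul, ← mul_smul]
    linarith [hy i _ (hFg h (Or.inr hh))]
  push Not at hFg
  have small_of_mem {h : G} (hh : h ∈ F) {j : I} (hj : h * g ∈ A j) :
      dist ((h * g) • x j) o < δ' :=
    IsDesignation.dist_smul_lt hdes Set.subset_union_right (Or.inl rfl) hg hFg hh hj
  have hyo : dist (g • y) o < ε / 2 := hwin _ _ fun h hh => by
    obtain ⟨j, hj⟩ := Set.mem_iUnion.mp (hcov ▸ Set.mem_univ (h * g))
    rw [ho, ← mul_smul]
    linarith [hy j _ hj, small_of_mem (Or.inr hh) hj,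
      dist_triangle ((h * g) • y) ((h * g) • x j) o]
  have hxo := small_of_mem (Or.inl rfl) (by rwa [one_mul])
  rw [one_mul] at hxo
  linarith [dist_triangle_right (g • y) (g • x i) o]

end Expansive

namespace LocalEndo

variable {G : Type u} {X : Type v} [Group G] [MetricSpace X] [MulAction G X] (c : LocalEndo G X)
  (Γ : Subgroup G)

/-- The points whose support lies in `Γ`: a pointed `Γ`-system, on which `c.f` acts as soon as
`Γ` contains the memory of `c.f`. -/
def supportedOn : SubMulAction Γ X where
  carrier := {x | c.supp x ⊆ Γ}
  smul_mem' γ _ hx _ hg := (Γ.mul_mem_cancel_right γ.2).mp (hx (mem_supp_smul.mp hg))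

/-- The special point, as a point of `c.supportedOn Γ`. -/
def zeroOn : c.supportedOn Γ :=
  ⟨c.o, show c.supp c.o ⊆ Γ from supp_o.trans_subset (Set.empty_subset _)⟩

instance [CompactSpace X] [ContinuousConstSMul G X] : CompactSpace (c.supportedOn Γ) := by
  have heq : (c.supportedOn Γ : Set X) = ⋂ g ∉ Γ, {x : X | dist (g • x) c.o ≤ c.η} := by
    ext x
    simp only [Set.mem_iInter]
    exact forall_congr' fun g => by rw [← not_imp_not, notMem_supp]; rfl
  have hclosed : IsClosed (c.supportedOn Γ : Set X) := heq ▸ isClosed_biInter fun g _ =>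
    isClosed_le ((continuous_const_smul g).dist continuous_const) continuous_const
  exact isCompact_iff_compactSpace.mp hclosed.isCompact

instance [ContinuousConstSMul G X] : ContinuousConstSMul Γ (c.supportedOn Γ) :=
  ⟨fun γ => (continuous_subtype_val.const_smul (γ : G)).subtype_mk _⟩

variable {c Γ}

theorem smul_zeroOn (γ : Γ) : γ • c.zeroOn Γ = c.zeroOn Γ := Subtype.ext (c.smul_o γ)

theorem eq_of_close_supportedOn (x y : c.supportedOn Γ)
    (h : ∀ γ : Γ, dist (γ • x) (γ • y) ≤ 4 * c.η) : x = y := by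
  refine Subtype.ext (c.eq_of_close _ _ fun g => ?_)
  by_cases hg : g ∈ Γ
  · exact h ⟨g, hg⟩
  · have hx := notMem_supp.mp fun h => hg (x.2 h)
    have hy := notMem_supp.mp fun h => hg (y.2 h)
    linarith [c.η_pos, dist_triangle_right (g • (x : X)) (g • (y : X)) c.o]

theorem mapsTo_supportedOn (hE : c.E ⊆ Γ) : Set.MapsTo c.f (c.supportedOn Γ) (c.supportedOn Γ) := by
  refine fun x hx => (supp_map_subset x).trans ?_
  rintro _ ⟨e, he, g, hg, rfl⟩
  exact Γ.mul_mem (inv_mem_iff.mp (hE he)) (hx hg)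

section Gluing

variable {δ : ℝ} {E : Set G}

theorem exists_mem_supportedOn (hδ : 0 < δ) (hE : E ⊆ Γ) (hglue : GluesAtScale c.o c.η δ E)
    {I : Type*} {A : I → Set Γ} {x : I → X}
    (hA : Pairwise fun i j => Disjoint (A i) (A j))
    (hborder : ∀ i, ∀ γ ∈ border (Subtype.val ⁻¹' E) (A i), dist (γ • x i) c.o < δ) :
    ∃ y : c.supportedOn Γ, ∀ i, ∀ γ ∈ A i, dist (γ • (y : X)) (γ • x i) < c.η := by
  obtain ⟨y, hy, hyo⟩ := exists_realization_of_pairwise_disjoint c.smul_o (Set.mem_univ c.o) hδ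
    (fun I A x _ => hglue I A x) (A := fun i => Subtype.val '' A i) (x := x)
    (fun _ => Set.mem_univ _)
    (fun i j hij => (Set.disjoint_image_iff Subtype.val_injective).mpr (hA hij)) (by
      rintro i _ ⟨⟨γ, hγ, rfl⟩, e, he, heγ⟩
      exact hborder i γ ⟨hγ, ⟨e, hE he⟩, he, fun h => heγ ⟨_, h, rfl⟩⟩)
  refine ⟨⟨y, fun g hg => by_contra fun hgΓ => ?_⟩, fun i γ hγ => hy i γ ⟨γ, hγ, rfl⟩⟩
  have hfar := hyo g (by rintro i ⟨γ, -, rfl⟩; exact hgΓ γ.2)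
  exact notMem_supp.mpr hfar.le hg

theorem exists_truncation (hδ : 0 < δ) (hE : E ⊆ Γ) (hglue : GluesAtScale c.o c.η δ E) (x : X) :
    ∃ y : c.supportedOn Γ, ∀ γ : Γ, dist (γ • (y : X)) (γ • x) < c.η := by
  obtain ⟨y, hy⟩ := exists_mem_supportedOn hδ hE hglue (I := Unit) (A := fun _ => Set.univ)
    (x := fun _ => x) Subsingleton.pairwise fun _ _ ⟨_, _, _, h⟩ => (h (Set.mem_univ _)).elim
  exact ⟨y, fun γ => hy () γ (Set.mem_univ _)⟩

variable [CompactSpace X] [ContinuousConstSMul G X]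

theorem isZeroGluing_supportedOn (hδ : 0 < δ) (hEfin : E.Finite) (hE : E ⊆ Γ)
    (hglue : GluesAtScale c.o c.η δ E) : IsZeroGluing Γ (c.zeroOn Γ) :=
  GluesAtScale.isZeroGluing smul_zeroOn c.η_pos eq_of_close_supportedOn hδ
    (hEfin.preimage Subtype.val_injective.injOn) fun _ _ x ⟨hdisj, _, hborder⟩ =>
      exists_mem_supportedOn hδ hE hglue (x := fun i => (x i : X)) hdisj hborder

theorem dense_isHomoclinic_supportedOn (hδ : 0 < δ) (hE : E ⊆ Γ)
    (hglue : GluesAtScale c.o c.η δ E) (hdense : Dense {x : X | IsHomoclinic G c.o x}) :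
    Dense {x : c.supportedOn Γ | IsHomoclinic Γ (c.zeroOn Γ) x} := by
  rw [Metric.dense_iff]
  intro x ε hε
  obtain ⟨F, hF, hwin⟩ :=
    exists_finite_expansivity_window (eq_of_close_supportedOn (c := c) (Γ := Γ)) hε
  have hnear : ∀ᶠ z in 𝓝 (x : X), ∀ γ ∈ F, dist (γ • z) (γ • (x : X)) < c.η :=
    hF.eventually_all.mpr fun γ _ =>
      Metric.tendsto_nhds.mp ((continuous_const_smul (γ : G)).tendsto (x : X)) c.η c.η_pos
  obtain ⟨z, hzhom, hzx⟩ := hdense.inter_nhds_nonempty hnear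
  obtain ⟨y, hyz⟩ := exists_truncation hδ hE hglue z
  obtain ⟨K, hK, hzK⟩ := hzhom c.η c.η_pos
  refine ⟨y, hwin y x fun γ hγ => ?_, isHomoclinic_of_expansive smul_zeroOn eq_of_close_supportedOn
    ((hK.preimage Subtype.val_injective.injOn).subset fun γ hγ => by_contra fun hγK => ?_)⟩
  · change dist (γ • (y : X)) (γ • (x : X)) ≤ _
    linarith [c.η_pos, hyz γ, hzx γ hγ, dist_triangle (γ • (y : X)) (γ • z) (γ • (x : X))]
  · have hfar : 4 * c.η < dist (γ • (y : X)) c.o := hγ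
    have hz : dist (γ • z) c.o < c.η := hzK γ hγK
    linarith [c.η_pos, hyz γ, dist_triangle (γ • (y : X)) (γ • z) c.o]

end Gluing

theorem pow_E_subset (hE : c.E ⊆ Γ) (j : ℕ) : c.E ^ j ⊆ Γ := by
  induction j with
  | zero => simp only [pow_zero, Set.one_subset, SetLike.mem_coe, Γ.one_mem]
  | succ j ih => exact (pow_succ c.E j).trans_subset ((Set.mul_subset_mul ih hE).trans (by simp))

theorem iterate_eq_o_of_truncation {n : ℕ} (hE : c.E ⊆ Γ)
    (htrunc : ∀ x : X, ∃ y : c.supportedOn Γ, ∀ γ : Γ, dist (γ • (y : X)) (γ • x) < c.η)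
    (hn : ∀ y : c.supportedOn Γ, c.f^[n] y = c.o) (x : X) : c.f^[n] x = c.o := by
  refine c.eq_of_close _ _ fun g => ?_
  obtain ⟨y, hy⟩ := htrunc (g • x)
  have hclose : dist ((1 : G) • c.f^[n] y) ((1 : G) • c.f^[n] (g • x)) ≤ 4 * c.η :=
    dist_smul_iterate_le fun k hk => by
      rw [mul_one]
      exact (hy ⟨k, pow_E_subset hE n hk⟩).le.trans (by linarith [c.η_pos])
  rwa [one_smul, one_smul, hn, iterate_smul, dist_comm, ← c.smul_o g] at hclose

end LocalEndo

theorem IsNilRigidOnSystems.of_fg {G : Type u} [Group G]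
    (h : ∀ Γ : Subgroup G, Γ.FG → IsNilRigidOnSystems.{u, v} Γ) : IsNilRigidOnSystems.{u, v} G := by
  rintro X _ _ _ _ o ho ⟨Δ, hΔ, hΔ1, hexp⟩ hglue hdense f hf hnil
  obtain ⟨η, rfl⟩ : ∃ η, Δ = 4 * η := ⟨Δ / 4, by ring⟩
  obtain ⟨c, rfl, rfl, rfl⟩ :=
    LocalEndo.exists_of_expansive (pos_of_mul_pos_right hΔ zero_le_four) ho hexp hf.1 hf.2.2 hnil
  obtain ⟨δ, hδ, E, hE, hglue⟩ := hglue c.η c.η_pos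
  let Γ := Subgroup.closure (c.E ∪ E)
  have hΓ : Γ.FG := (Subgroup.fg_iff Γ).mpr ⟨_, rfl, c.finite_E.union hE⟩
  have hcΓ : c.E ⊆ Γ := Set.subset_union_left.trans Subgroup.subset_closure
  have hEΓ : E ⊆ Γ := Set.subset_union_right.trans Subgroup.subset_closure
  have hmap := LocalEndo.mapsTo_supportedOn hcΓ
  obtain ⟨n, hn⟩ := h Γ hΓ (c.supportedOn Γ) (c.zeroOn Γ) LocalEndo.smul_zeroOn
    ⟨4 * c.η, hΔ, hΔ1, LocalEndo.eq_of_close_supportedOn⟩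
    (LocalEndo.isZeroGluing_supportedOn hδ hE hEΓ hglue)
    (LocalEndo.dense_isHomoclinic_supportedOn hδ hEΓ hglue hdense) hmap.restrict
    ⟨c.continuous_f.restrict hmap, Subtype.ext LocalEndo.map_o,
      fun γ x => Subtype.ext (c.map_smul γ x)⟩
    fun x => tendsto_subtype_rng.mpr (by simp only [hmap.coe_iterate_restrict]; exact c.nil x)
  exact ⟨n, LocalEndo.iterate_eq_o_of_truncation hcΓ (LocalEndo.exists_truncation hδ hEΓ hglue)
    fun y => by rw [← hmap.coe_iterate_restrict, hn]; rfl⟩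

/-! ### Nil-rigidity with and without tiers -/

theorem residuallyFinite_of_injective {G K : Type*} [Group G] [Group K] [Group.ResiduallyFinite G]
    {f : K →* G} (hf : Function.Injective f) : Group.ResiduallyFinite K := by
  rw [Group.residuallyFinite_iff_exists_finiteIndexNormalSubgroup]
  intro g hg
  obtain ⟨H, hgH⟩ := Group.exists_finiteIndexNormalSubgroup_notMem (f g)
    ((map_ne_one_iff f hf).mpr hg)
  exact ⟨H.comap f, hgH⟩

namespace TieredSystem

section OfSystem

variable {G : Type u} [Group G] {X : Type v} [MetricSpace X] [CompactSpace X] [MulAction G X]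
  [ContinuousConstSMul G X] {o : X}

/-- An expansive pointed system, as a tiered system with a single tier. The tier is the top
`SubMulAction` rather than `Set.univ`, so that the group acts on it. -/
def ofSystem (ho : ∀ g : G, g • o = o) (hexp : IsExpansive G X) : TieredSystem.{u, v} where
  Space := X
  zero := o
  Tier := PUnit
  Grp _ := G
  set _ := (⊤ : SubMulAction G X)
  isCompact_set _ := isCompact_univ
  mulAction _ := inferInstanceAs (MulAction G (⊤ : SubMulAction G X))
  continuousConstSMul _ := ⟨fun g => (continuous_subtype_val.const_smul g).subtype_mk _⟩
  zero_mem _ := trivial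
  smul_zero _ g := Subtype.ext (ho g)
  expansive _ := by
    obtain ⟨Δ, hΔ, hΔ1, h⟩ := hexp
    exact ⟨Δ, hΔ, hΔ1, fun x y hxy => Subtype.ext (h x y hxy)⟩
  set_mono _ := le_rfl
  hom _ := MonoidHom.id G
  hom_surjective _ := Function.surjective_id
  hom_finite_fibre _ g := Set.finite_singleton g
  hom_refl _ := rfl
  hom_comp _ _ := rfl
  hom_smul _ _ _ := rfl

theorem classFour_ofSystem (ho : ∀ g : G, g • o = o) (hexp : IsExpansive G X)
    (hglue : IsZeroGluing G o) (hdense : Dense {x : X | IsHomoclinic G o x}) {f : X → X}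
    (hf : IsEndomorphism G o f) : classFour (ofSystem ho hexp) f := by
  refine ⟨⟨⟨hf.1, fun _ _ _ x _ g => hf.2.2 g x.1⟩,
    fun t => ⟨t, le_rfl, fun k => Set.subset_univ _⟩,
    fun t => ⟨t, le_rfl, fun ε hε => ?_⟩, fun t x _ ε hε => ?_⟩,
    inferInstanceAs (Subsingleton PUnit)⟩
  · obtain ⟨δ, hδ, E, hE, h⟩ := hglue ε hε
    refine ⟨δ, hδ, E, hE, fun I A x _ hA => ?_⟩
    obtain ⟨y, hy⟩ := h I A (fun i => (x i).1) hA
    exact ⟨⟨y, trivial⟩, hy⟩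
  · obtain ⟨y, hy, hxy⟩ := hdense.exists_dist_lt x hε
    exact ⟨t, le_rfl, ⟨y, trivial⟩, hxy, hy⟩

end OfSystem

section SingleTier

variable {𝒳 : TieredSystem.{u, v}} [Subsingleton 𝒳.Tier] {f : 𝒳.Space → 𝒳.Space}

theorem IsStabilizing.mapsTo (hf : 𝒳.IsStabilizing f) (t : 𝒳.Tier) :
    Set.MapsTo f (𝒳.set t) (𝒳.set t) := by
  obtain ⟨s, -, hs⟩ := hf t
  obtain rfl := Subsingleton.elim s t
  exact Set.mapsTo_iff_image_subset.mpr (hs 1)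

theorem IsWeaklyZeroGluing.isZeroGluing (h : 𝒳.IsWeaklyZeroGluing) (t : 𝒳.Tier) :
    IsZeroGluing (𝒳.Grp t) (𝒳.zeroAt t) := by
  obtain ⟨w, -, hw⟩ := h t
  obtain rfl := Subsingleton.elim w t
  intro ε hε
  obtain ⟨δ, hδ, E, hE, hglue⟩ := hw ε hε
  exact ⟨δ, hδ, E, hE, fun I A x => hglue I A x fun i => (x i).2⟩

theorem HasWeaklyDenseHomoclinicPoints.dense (h : 𝒳.HasWeaklyDenseHomoclinicPoints)
    (t : 𝒳.Tier) : Dense {x : 𝒳.set t | IsHomoclinic (𝒳.Grp t) (𝒳.zeroAt t) x} := by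
  refine Metric.dense_iff.mpr fun x ε hε => ?_
  obtain ⟨t', -, y, hxy, hy⟩ := h t x x.2 ε hε
  obtain rfl := Subsingleton.elim t' t
  exact ⟨y, Metric.mem_ball'.mpr hxy, hy⟩

end SingleTier

end TieredSystem

theorem IsNilRigidOn.isNilRigidOnSystems {ℭ : EvolutionClass.{u, v}} {G K : Type u} [Group G]
    [Group K] (hG : IsNilRigidOn ℭ G) (e : K ≃* G)
    (hℭ : ∀ (𝒳 : TieredSystem.{u, v}) (f : 𝒳.Space → 𝒳.Space), classFour 𝒳 f →
      (𝒳.Grp ⊥ ≃* K) → ℭ 𝒳 f) : IsNilRigidOnSystems.{u, v} K := by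
  intro X _ _ _ _ o ho hexp hglue hdense f hf hnil
  have h4 := TieredSystem.classFour_ofSystem ho hexp hglue hdense hf
  obtain ⟨n, hn⟩ := hG (TieredSystem.ofSystem ho hexp) ⟨e⟩ f h4.1.1
    (hℭ _ _ h4 (MulEquiv.refl K)) hnil ⊥
  exact ⟨n, fun x => hn x trivial⟩

theorem IsNilRigidOnSystems.of_locally {G K : Type u} [Group G] [Group K] (e : K ≃* G)
    (h : IsLocallyNilRigidOn classTwo.{u, v} G ∨ IsLocallyNilRigidOn classFour.{u, v} G ∨
      (IsLocallyNilRigidOn classThree.{u, v} G ∧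
        ∀ H : Subgroup G, H.FG → Group.ResiduallyFinite H)) :
    IsNilRigidOnSystems.{u, v} K := by
  refine .of_fg fun Γ hΓ => ?_
  let e' : Γ ≃* Γ.map e.toMonoidHom := Γ.equivMapOfInjective e.toMonoidHom e.injective
  have hfg : (Γ.map e.toMonoidHom).FG := subgroup_fg_map e.toMonoidHom hΓ
  rcases h with h | h | ⟨h, hRF⟩
  · exact (h _ hfg).isNilRigidOnSystems e' fun _ _ h4 _ => h4.1
  · exact (h _ hfg).isNilRigidOnSystems e' fun _ _ h4 _ => h4
  · refine (h _ hfg).isNilRigidOnSystems e' fun 𝒳 f ⟨h2, hT⟩ e₀ => ⟨h2, fun t => ?_⟩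
    have := hRF _ hfg
    rw [hT.elim t ⊥]
    exact residuallyFinite_of_injective (f := (e₀.trans e').toMonoidHom) (e₀.trans e').injective

theorem IsNilRigidOnSystems.isNilpotentMapOn {𝒳 : TieredSystem.{u, v}} {f : 𝒳.Space → 𝒳.Space}
    {t : 𝒳.Tier} (h : IsNilRigidOnSystems.{u, v} (𝒳.Grp t)) (h4 : classFour 𝒳 f)
    (hnil : IsAsymptoticallyNilpotent 𝒳.zero f) : IsNilpotentMapOn 𝒳.zero f (𝒳.set t) := by
  obtain ⟨⟨hf, hstab, hglue, hdense⟩, hT⟩ := h4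
  have : CompactSpace (𝒳.set t) := isCompact_iff_compactSpace.mp (𝒳.isCompact_set t)
  have hmap := hstab.mapsTo t
  obtain ⟨n, hn⟩ := h (𝒳.set t) (𝒳.zeroAt t) (𝒳.smul_zero t) (𝒳.expansive t)
    (hglue.isZeroGluing t) (hdense.dense t) hmap.restrict
    ⟨hf.1.restrict hmap, Subtype.ext (hnil.map_zero hf.1),
      fun g x => Subtype.ext (hf.iterate_smul (fun k => hmap.iterate k x.2) g 1)⟩
    fun x => tendsto_subtype_rng.mpr (by simp only [hmap.coe_iterate_restrict]; exact hnil x)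
  exact ⟨n, fun x hx => by
    rw [← hmap.coe_iterate_restrict ⟨x, hx⟩, hn]
    rfl⟩

theorem mainTheorem1 :
    -- nilpotency of asymptotically nilpotent endomorphisms
    (∀ (G : Type u) [Group G],
      (∀ H : Subgroup G, H.FG →
        Group.ResiduallyFinite H ∧ HasLocallyVirtuallyAbelianSeries H) →
      ∀ (X : Type v) [MetricSpace X] [CompactSpace X] [MulAction G X] [ContinuousConstSMul G X]
        (o : X), (∀ g : G, g • o = o) →
        IsExpansive G X → IsZeroGluing G o → Dense {x : X | IsHomoclinic G o x} →
        ∀ f : X → X, IsEndomorphism G o f → IsAsymptoticallyNilpotent o f →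
          IsNilpotentMap o f) ∧
    -- nil-rigidity on tiered systems with residually finite groups
    (∀ (G : Type u) [Group G], Group.ResiduallyFinite G → HasLocallyVirtuallyAbelianSeries G →
      IsNilRigidOn classThree.{u, v} G) ∧
    -- from local nil-rigidity to nil-rigidity on single-tier systems
    (∀ (G : Type u) [Group G],
      (IsLocallyNilRigidOn classTwo.{u, v} G ∨ IsLocallyNilRigidOn classFour.{u, v} G ∨
        (IsLocallyNilRigidOn classThree.{u, v} G ∧
          ∀ H : Subgroup G, H.FG → Group.ResiduallyFinite H)) →
      IsNilRigidOn classFour.{u, v} G) := by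
  refine ⟨?_, fun G _ _ hser => .classThree_of_series hser, ?_⟩
  · intro G _ hG X _ _ _ _ o ho hexp hglue hdense f hf hnil
    have hlocal : IsLocallyNilRigidOn classThree.{u, v} G :=
      fun H hH => .classThree_of_series (hG H hH).2
    obtain ⟨n, hn⟩ := IsNilRigidOnSystems.of_locally (MulEquiv.refl G)
      (Or.inr (Or.inr ⟨hlocal, fun H hH => (hG H hH).1⟩)) X o ho hexp hglue hdense f hf hnil
    exact ⟨n, Set.eq_singleton_iff_unique_mem.mpr
      ⟨⟨o, hn o⟩, Set.forall_mem_range.mpr hn⟩⟩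
  · rintro G _ h 𝒳 ⟨e⟩ f - h4 hnil t
    obtain rfl := h4.2.elim t ⊥
    exact (IsNilRigidOnSystems.of_locally e h).isNilpotentMapOn h4 hnil
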